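/- Let $n,m\ge 1$ be integers, let $1<p_1,\dots,p_m<\infty$, $\vec P=(p_1,\dots,p_m)$, $\frac1p=\frac1{p_1}+\cdots+\frac1{p_m}$, $0<\alpha<mn$, $\frac1m<p<\frac n\alpha$ and $\frac1q=\frac1p-\frac\alpha n$. Write $p_i'=p_i/(p_i-1)$; cubes are nondegenerate cubes $Q\subset\mathbb R^n$ with sides parallel to the axes. For locally integrable $f_1,\dots,f_m$ on $\mathbb R^n$ put $$\mathcal M_\alpha(\vec f)(x)=\sup_{Q\ni x}\prod_{i=1}^m\frac1{|Q|^{1-\frac{\alpha}{mn}}}\int_Q|f_i(y)|\,dy .$$ For a vector $\vec\omega=(\omega_1,\dots,\omega_m)$ of nonnegative measurable functions on $\mathbb R^n$ put $\nu_{\vec\omega}=\prod_{i=1}^m\omega_i$, $\sigma_i=\omega_i^{-p_i'}$, and $$[\vec\omega]_{A_{(\vec P,q)}}=\sup_Q\Big(\frac1{|Q|}\int_Q\nu_{\vec\omega}^q\Big)\prod_{i=1}^m\Big(\frac1{|Q|}\int_Q\omega_i^{-p_i'}\Big)^{q/p_i'} ;$$ $\vec\omega\in A_{(\vec P,q)}$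 means that $\sup_Q\big(\frac1{|Q|}\int_Q\nu_{\vec\omega}^q\big)^{1/q}\prod_{i=1}^m\big(\frac1{|Q|}\int_Q\omega_i^{-p_i'}\big)^{1/p_i'}<\infty$, that is, $[\vec\omega]_{A_{(\vec P,q)}}<\infty$. For a weight $\sigma$ put $$[\sigma]_{A_\infty}=\sup_Q\frac1{\sigma(Q)}\int_Q M(\sigma\chi_Q)(x)\,dx,\qquad \sigma(Q)=\int_Q\sigma,\qquad M g(x)=\sup_{Q\ni x}\frac1{|Q|}\int_Q|g| .$$ (All these quantities take values in $[0,\infty]$, with $0^{-p_i'}=\infty$ and $0\cdot\infty=0$.) Then there is a finite constant $C=C_{n,m,\vec P,q}$ such that, for all $\vec\omega\in A_{(\vec P,q)}$ and all locally integrable $f_1,\dots,f_m$, $$\|\mathcal M_\alpha(\vec f)\|_{L^q(\nu_{\vec\omega}^q)}\le C\,[\vec\omega]_{A_{(\vec P,q)}}^{1/q}\prod_{i=1}^m[\sigma_i]_{A_\infty}^{1/p_i}\prod_{i=1}^m\|f_i\|_{L^{p_i}(\omega_i^{p_i})}.$$ -/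

import Mathlib

open MeasureTheory
open scoped NNReal ENNReal

noncomputable section

namespace MultilinearFractional

/-- A (closed, nondegenerate) cube of `ℝⁿ` with sides parallel to the axes. -/
def IsCube {n : ℕ} (Q : Set (Fin n → ℝ)) : Prop :=
  ∃ (a : Fin n → ℝ) (l : ℝ), 0 < l ∧ Q = Set.Icc a (fun j => a j + l)

/-- The multilinear fractional maximal operator
`𝓜_α(f₁,…,f_m)(x) = sup_{Q ∋ x} ∏ᵢ |Q|^{-(1 - α/(mn))} ∫_Q |fᵢ|`. -/
def fractionalMaximal {n m : ℕ} (α : ℝ) (f : Fin m → (Fin n → ℝ) → ℂ) (x : Fin n → ℝ) : ℝ≥0∞ :=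
  ⨆ (Q : Set (Fin n → ℝ)) (_ : IsCube Q) (_ : x ∈ Q),
    ∏ i, (∫⁻ y in Q, ‖f i y‖ₑ) / volume Q ^ (1 - α / ((m : ℝ) * n))

/-- The Hardy–Littlewood maximal function `M g(x) = sup_{Q ∋ x} |Q|⁻¹ ∫_Q g` of a nonnegative
function, over cubes with sides parallel to the axes. -/
def hardyLittlewoodMaximal {n : ℕ} (g : (Fin n → ℝ) → ℝ≥0∞) (x : Fin n → ℝ) : ℝ≥0∞ :=
  ⨆ (Q : Set (Fin n → ℝ)) (_ : IsCube Q) (_ : x ∈ Q), ⨍⁻ y in Q, g y ∂volume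

/-- The (Fujii–Wilson) constant `[σ]_{A_∞} = sup_Q σ(Q)⁻¹ ∫_Q M(σ χ_Q)`. -/
def aInftyConst {n : ℕ} (σ : (Fin n → ℝ) → ℝ≥0∞) : ℝ≥0∞ :=
  ⨆ (Q : Set (Fin n → ℝ)) (_ : IsCube Q),
    (∫⁻ x in Q, hardyLittlewoodMaximal (Q.indicator σ) x) / ∫⁻ x in Q, σ x

/-- `ν_ω = ∏ᵢ ωᵢ`. -/
def prodWeight {n m : ℕ} (ω : Fin m → (Fin n → ℝ) → ℝ≥0) (x : Fin n → ℝ) : ℝ≥0∞ :=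
  ∏ i, (ω i x : ℝ≥0∞)

/-- `σ = w^{-p'}` where `p' = p / (p - 1)`; it takes the value `∞` where `w` vanishes. -/
def dualWeight {n : ℕ} (p : ℝ) (w : (Fin n → ℝ) → ℝ≥0) (x : Fin n → ℝ) : ℝ≥0∞ :=
  (w x : ℝ≥0∞) ^ (-p.conjExponent)

/-- The constant `[ω]_{A_(P,q)} = sup_Q (|Q|⁻¹ ∫_Q ν_ω^q) ∏ᵢ (|Q|⁻¹ ∫_Q ωᵢ^{-pᵢ'})^{q/pᵢ'}`. -/
def aConst {n m : ℕ} (P : Fin m → ℝ) (q : ℝ) (ω : Fin m → (Fin n → ℝ) → ℝ≥0) : ℝ≥0∞ :=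
  ⨆ (Q : Set (Fin n → ℝ)) (_ : IsCube Q),
    (⨍⁻ x in Q, prodWeight ω x ^ q ∂volume) *
      ∏ i, (⨍⁻ x in Q, dualWeight (P i) (ω i) x ∂volume) ^ (q / (P i).conjExponent)

/-- The class `A_(P,q)` of vectors of nonnegative measurable functions. -/
def MemA {n m : ℕ} (P : Fin m → ℝ) (q : ℝ) (ω : Fin m → (Fin n → ℝ) → ℝ≥0) : Prop :=
  (∀ i, AEMeasurable (ω i) volume) ∧
    (⨆ (Q : Set (Fin n → ℝ)) (_ : IsCube Q),
      (⨍⁻ x in Q, prodWeight ω x ^ q ∂volume) ^ (1 / q) *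
        ∏ i, (⨍⁻ x in Q, dualWeight (P i) (ω i) x ∂volume) ^ (1 / (P i).conjExponent)) < ∞

/-- The measure `w(x)^r dx`, so that `L^r(w^r)` is `L^r` of this measure. -/
def powMeasure {n : ℕ} (w : (Fin n → ℝ) → ℝ≥0∞) (r : ℝ) : Measure (Fin n → ℝ) :=
  volume.withDensity (fun x => w x ^ r)

end MultilinearFractional

end

/-! Every cube lies in a comparable cube of one of `2 ^ n` dyadic grids (the one-third trick), so it
suffices to bound the dyadic maximal operator of one grid, and by monotone convergence that of a
finite family `G` of its cubes. Such a family is laminar, and the core estimate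
`Laminar.lintegral_iSup_le` uses nothing else about cubes.

Write `F Q` for the product of fractional averages. Select principal cubes `S` in `G`: each cube of
`G` lies in some `R ∈ S` with `F Q ≤ 2 ^ m * F R`, while `F` jumps by more than `2 ^ m` between
nested members of `S`. The maximal function to the power `q` is then at most a constant times the
sum over `S` of `F R ^ q` on `R`. The jump and Hölder's inequality with `m` equal exponents show
that the members of `S` strictly inside `R` fill at most half of `R`, so `S` is sparse for Lebesgue
measure.

With `g_i = |f_i| / σ_i`, the `A_(P,q)` condition on `R` bounds `F R ^ q * ν R` by `K =
[ω]_{A_(P,q)}` times the product of `((average of g_i over R with respect to σ_i) ^ P_i * σ_i R) ^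
(q / P_i)`. Since `∑ p / P_i = 1` and `q ≥ p`, the sum over `S` moves inside each factor. There the
Carleson embedding theorem applies to `σ_i`: sparseness, and the maximal function of `σ_i` cut off
to a cube, give the packing constant `2 * [σ_i]_{A_∞}`. The power `q / P_i` followed by the `q`-th
root produces the exponents `1 / P_i` and `1 / q` of the theorem. -/

namespace MultilinearFractional

/-! ### Laminar families and principal sets. -/

/-- A finite family of sets, any two of which are nested or disjoint. -/
def Laminar {X : Type*} (G : Finset (Set X)) : Prop :=
  ∀ Q ∈ G, ∀ R ∈ G, Q ⊆ R ∨ R ⊆ Q ∨ Disjoint Q R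

theorem Laminar.subset {X : Type*} {G H : Finset (Set X)} (hG : Laminar G) (h : H ⊆ G) :
    Laminar H :=
  fun Q hQ R hR => hG Q (h hQ) R (h hR)

theorem Laminar.exists_disjoint_cover {X : Type*} {G : Finset (Set X)} (hG : Laminar G) :
    ∃ H ⊆ G, (H : Set (Set X)).PairwiseDisjoint id ∧ ∀ Q ∈ G, ∃ R ∈ H, Q ⊆ R := by
  classical
  refine ⟨G.filter (Maximal (· ∈ G)), Finset.filter_subset _ _, ?_, ?_⟩
  · intro Q hQ R hR hne
    simp only [Finset.coe_filter, Set.mem_ofPred_eq] at hQ hR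
    rcases hG Q hQ.1 R hR.1 with h | h | h
    · exact absurd (hQ.2.eq_of_le hR.1 h) hne
    · exact absurd (hR.2.eq_of_le hQ.1 h).symm hne
    · exact h
  · intro Q hQ
    obtain ⟨R, hQR, hR⟩ := G.exists_le_maximal hQ
    exact ⟨R, Finset.mem_filter.2 ⟨hR.1, hR⟩, hQR⟩

/-- Selection of principal sets. -/
theorem exists_principal {X : Type*} (F : Set X → ℝ≥0∞) {A : ℝ≥0∞} (hA : 1 ≤ A)
    (G : Finset (Set X)) :
    ∃ S ⊆ G, (∀ Q ∈ G, ∃ R ∈ S, Q ⊆ R ∧ F Q ≤ A * F R) ∧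
      ∀ T ∈ S, ∀ R ∈ S, T ⊂ R → A * F R < F T := by
  classical
  induction G using Finset.strongInduction with
  | H G ih =>
    rcases G.eq_empty_or_nonempty with rfl | hne
    · exact ⟨∅, by simp⟩
    -- An inclusion-minimal set is decided last: no selected set lies strictly inside it, so adding
    -- it only creates pairs in which it is the smaller member.
    obtain ⟨Q₀, hQ₀⟩ := G.exists_minimal hne
    obtain ⟨S, hSG, hcov, hS⟩ := ih (G.erase Q₀) (Finset.erase_ssubset hQ₀.1)
    have hSG' : S ⊆ G := hSG.trans (Finset.erase_subset _ _)
    by_cases h : ∃ R ∈ S, Q₀ ⊆ R ∧ F Q₀ ≤ A * F R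
    · refine ⟨S, hSG', fun Q hQ => ?_, hS⟩
      by_cases hQQ : Q = Q₀
      · rw [hQQ]; exact h
      · exact hcov Q (Finset.mem_erase.2 ⟨hQQ, hQ⟩)
    · push Not at h
      refine ⟨insert Q₀ S, Finset.insert_subset hQ₀.1 hSG', fun Q hQ => ?_, ?_⟩
      · by_cases hQQ : Q = Q₀
        · exact ⟨Q₀, Finset.mem_insert_self _ _, hQQ.le, by
            rw [hQQ]; exact le_mul_of_one_le_left' hA⟩
        · obtain ⟨R, hR, h'⟩ := hcov Q (Finset.mem_erase.2 ⟨hQQ, hQ⟩)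
          exact ⟨R, Finset.mem_insert_of_mem hR, h'⟩
      · intro T hT R hR hTR
        rcases Finset.mem_insert.1 hR with rfl | hR
        · have hTG : T ∈ G := by
            rcases Finset.mem_insert.1 hT with rfl | hT
            · exact hQ₀.1
            · exact hSG' hT
          exact absurd (hQ₀.2 hTG hTR.le) hTR.not_ge
        · rcases Finset.mem_insert.1 hT with h' | hT
          · subst h'
            exact h R ‹R ∈ S› hTR.le
          · exact hS T hT R hR hTR

open scoped Classical in
/-- The sum over a laminar family is controlled by the union of its members. -/
theorem Laminar.sum_le_of_packing {X : Type*} [MeasurableSpace X] {G : Finset (Set X)}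
    (hG : Laminar G) (hmeas : ∀ Q ∈ G, MeasurableSet Q) (μ κ : Measure X) (c : Set X → ℝ≥0∞)
    {Λ B : ℝ≥0∞}
    (hpack : ∀ R ∈ G, ∑ Q ∈ G with Q ⊆ R, c Q ≤ Λ * μ R) (hμ : ∀ R ∈ G, μ R ≤ B * κ R) :
    ∑ Q ∈ G, c Q ≤ Λ * (B * κ Set.univ) := by
  classical
  obtain ⟨H, hHG, hdisj, hcov⟩ := hG.exists_disjoint_cover
  calc ∑ Q ∈ G, c Q ≤ ∑ R ∈ H, ∑ Q ∈ G with Q ⊆ R, c Q := by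
        rw [Finset.sum_comm' (t' := G) (s' := fun Q => H.filter (Q ⊆ ·)) (by simp; tauto)]
        refine Finset.sum_le_sum fun Q hQ => ?_
        obtain ⟨R, hR, hQR⟩ := hcov Q hQ
        exact Finset.single_le_sum (f := fun _ => c Q) (fun _ _ => zero_le)
          (Finset.mem_filter.2 ⟨hR, hQR⟩)
    _ ≤ ∑ R ∈ H, Λ * (B * κ R) := Finset.sum_le_sum fun R hR =>
        (hpack R (hHG hR)).trans (mul_le_mul_right (hμ R (hHG hR)) _)
    _ = Λ * (B * κ (⋃ R ∈ H, R)) := by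
        rw [measure_biUnion_finset (f := fun R => R) hdisj fun R hR => hmeas R (hHG hR),
          Finset.mul_sum, Finset.mul_sum]
    _ ≤ Λ * (B * κ Set.univ) := by gcongr; exact Set.subset_univ _

/-! ### Carleson embedding. -/

/-- Layer-cake formula for a Dirac mass. It lets a sum of powers of averages be rewritten as an
integral over levels `t` of sums over the sets whose average exceeds `t`. -/
theorem ofReal_rpow_eq_lintegral (a : ℝ) (ha : 0 ≤ a) {p : ℝ} (hp : 0 < p) :
    ENNReal.ofReal (a ^ p) = ENNReal.ofReal p *
      ∫⁻ t in Set.Ioi (0 : ℝ), (if t < a then 1 else 0) * ENNReal.ofReal (t ^ (p - 1)) := by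
  have := lintegral_rpow_eq_lintegral_meas_lt_mul (Measure.dirac ()) (f := fun _ => a)
    (Filter.Eventually.of_forall fun _ => ha) aemeasurable_const hp
  simp only [lintegral_const, measure_univ, mul_one] at this
  rw [this]
  congr 1
  refine lintegral_congr fun t => ?_
  by_cases h : t < a <;> simp [h]

/-- Weak-type bound: the part of `Q` where `g ≤ t / 2` contributes at most half of `t * μ Q`, so the
rest of the integral lives on `{t < 2 * g}`. Truncating to this set is what makes the later
integration in `t` converge. -/
theorem measure_le_of_lt_average {X : Type*} [MeasurableSpace X] (μ : Measure X) {g : X → ℝ}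
    (hg : Measurable g) {Q : Set X} (hQ : MeasurableSet Q) (hQ' : μ Q ≠ ∞)
    {t : ℝ} (ht : 0 < t) (h : ENNReal.ofReal t * μ Q ≤ ∫⁻ x in Q, ENNReal.ofReal (g x) ∂μ) :
    μ Q ≤ ENNReal.ofReal (2 / t) *
      (μ.withDensity fun x => ENNReal.ofReal (g x)).restrict {x | t < 2 * g x} Q := by
  have hset : MeasurableSet {x | t < 2 * g x} := measurableSet_lt measurable_const (hg.const_mul 2)
  rw [Measure.restrict_apply hQ, withDensity_apply _ (hQ.inter hset)]
  have h1 : ∫⁻ x in Q, ENNReal.ofReal (g x) ∂μ ≤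
      ENNReal.ofReal (t / 2) * μ Q + ∫⁻ x in Q ∩ {x | t < 2 * g x}, ENNReal.ofReal (g x) ∂μ := by
    rw [← lintegral_inter_add_sdiff _ Q hset, add_comm]
    gcongr
    calc ∫⁻ x in Q \ {x | t < 2 * g x}, ENNReal.ofReal (g x) ∂μ
        ≤ ∫⁻ x in Q \ {x | t < 2 * g x}, ENNReal.ofReal (t / 2) ∂μ := by
          refine setLIntegral_mono' (hQ.diff hset) fun x hx => ENNReal.ofReal_le_ofReal ?_
          have := hx.2
          simp only [Set.mem_ofPred_eq, not_lt] at this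
          linarith
      _ ≤ ENNReal.ofReal (t / 2) * μ Q := by
          rw [setLIntegral_const]; gcongr; exact Set.sdiff_subset
  have h2 : ENNReal.ofReal (t / 2) * μ Q ≤
      ∫⁻ x in Q ∩ {x | t < 2 * g x}, ENNReal.ofReal (g x) ∂μ := by
    have h3 := h.trans h1
    rw [show t = t / 2 + t / 2 by ring, ENNReal.ofReal_add (by positivity) (by positivity),
      add_mul, ← show t = t / 2 + t / 2 by ring] at h3
    exact (ENNReal.add_le_add_iff_left (ENNReal.mul_ne_top ENNReal.ofReal_ne_top hQ')).1 h3
  calc μ Q = ENNReal.ofReal (2 / t) * (ENNReal.ofReal (t / 2) * μ Q) := by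
        rw [← mul_assoc, ← ENNReal.ofReal_mul (by positivity)]
        rw [show 2 / t * (t / 2) = 1 by field_simp]; simp
    _ ≤ _ := by gcongr

open scoped Classical in
/-- The Carleson embedding theorem for a finite laminar family. -/
theorem Laminar.carleson_embedding {X : Type*} [MeasurableSpace X] {G : Finset (Set X)}
    (hG : Laminar G) (hmeas : ∀ Q ∈ G, MeasurableSet Q) (μ : Measure X)
    (h0 : ∀ Q ∈ G, μ Q ≠ 0) (htop : ∀ Q ∈ G, μ Q ≠ ∞) {Λ : ℝ≥0∞}
    (hpack : ∀ R ∈ G, ∑ Q ∈ G with Q ⊆ R, μ Q ≤ Λ * μ R) {g : X → ℝ} (hg : Measurable g)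
    (hg0 : ∀ x, 0 ≤ g x) (hint : ∀ Q ∈ G, ∫⁻ x in Q, ENNReal.ofReal (g x) ∂μ ≠ ∞)
    {p : ℝ} (hp : 1 < p) :
    ∑ Q ∈ G, ((∫⁻ x in Q, ENNReal.ofReal (g x) ∂μ) / μ Q) ^ p * μ Q ≤
      ENNReal.ofReal (p * (2 * (2 ^ (p - 1) / (p - 1)))) * Λ *
        ∫⁻ x, ENNReal.ofReal (g x) ^ p ∂μ := by
  classical
  set a : Set X → ℝ≥0∞ := fun Q => (∫⁻ x in Q, ENNReal.ofReal (g x) ∂μ) / μ Q with ha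
  have hatop : ∀ Q ∈ G, a Q ≠ ∞ := fun Q hQ => ENNReal.div_ne_top (hint Q hQ) (h0 Q hQ)
  set κ : Measure X := μ.withDensity fun x => ENNReal.ofReal (g x)
  -- The weak-type bound costs `1 / t`, lowering the layer-cake weight from `t ^ (p - 1)` to `t ^ (p
  -- - 2)`. Integrating this against `κ = g μ` is the layer-cake formula of exponent `p - 1`, and
  -- returns the integral of `g ^ p`.
  set φ : ℝ → ℝ≥0∞ := fun t => κ {x | t < 2 * g x} * ENNReal.ofReal (t ^ (p - 1 - 1)) with hφ
  have hφm : Measurable φ := by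
    refine Measurable.mul (Antitone.measurable fun s t hst => measure_mono fun x hx => ?_) (by fun_prop)
    exact lt_of_le_of_lt hst hx
  have hlayer : ∫⁻ t in Set.Ioi (0 : ℝ), φ t =
      ENNReal.ofReal (2 ^ (p - 1) / (p - 1)) * ∫⁻ x, ENNReal.ofReal (g x) ^ p ∂μ := by
    have h1 := lintegral_rpow_eq_lintegral_meas_lt_mul κ (f := fun x => 2 * g x)
      (Filter.Eventually.of_forall fun x => by have := hg0 x; simp only [Pi.zero_apply]; positivity)
      (by fun_prop) (p := p - 1) (by linarith)
    rw [lintegral_withDensity_eq_lintegral_mul _ (by fun_prop) (by fun_prop)] at h1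
    have h2 : ∀ x, ((fun x => ENNReal.ofReal (g x)) * fun x => ENNReal.ofReal ((2 * g x) ^ (p - 1))) x
        = ENNReal.ofReal (2 ^ (p - 1)) * ENNReal.ofReal (g x) ^ p := by
      intro x
      have := hg0 x
      simp only [Pi.mul_apply]
      rw [ENNReal.ofReal_rpow_of_nonneg this (by linarith), ← ENNReal.ofReal_mul this,
        ← ENNReal.ofReal_mul (by positivity), Real.mul_rpow (by norm_num) this]
      congr 1
      rcases this.eq_or_lt with h | h
      · simp [← h, Real.zero_rpow (show p ≠ 0 by linarith)]
      · rw [Real.rpow_sub_one h.ne']; field_simp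
    simp_rw [h2] at h1
    rw [lintegral_const_mul _ (by fun_prop)] at h1
    have hp1 : ENNReal.ofReal (p - 1) ≠ 0 := by simpa using hp
    rw [ENNReal.ofReal_div_of_pos (by linarith), div_eq_mul_inv, mul_right_comm, h1,
      mul_comm, ← mul_assoc, ENNReal.inv_mul_cancel hp1 ENNReal.ofReal_ne_top, one_mul]
  have hterm : ∀ Q ∈ G, a Q ^ p * μ Q = ENNReal.ofReal p * ∫⁻ t in Set.Ioi (0 : ℝ),
      (if t < (a Q).toReal then μ Q else 0) * ENNReal.ofReal (t ^ (p - 1)) := by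
    intro Q hQ
    have h1 : a Q ^ p = ENNReal.ofReal ((a Q).toReal ^ p) := by
      rw [← ENNReal.ofReal_rpow_of_nonneg ENNReal.toReal_nonneg (by linarith),
        ENNReal.ofReal_toReal (hatop Q hQ)]
    rw [h1, ofReal_rpow_eq_lintegral _ ENNReal.toReal_nonneg (by linarith), mul_assoc,
      ← lintegral_mul_const' _ _ (htop Q hQ)]
    congr 1
    refine lintegral_congr fun t => ?_
    split_ifs <;> simp [mul_comm]
  calc ∑ Q ∈ G, a Q ^ p * μ Q
      = ENNReal.ofReal p * ∫⁻ t in Set.Ioi (0 : ℝ),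
        (∑ Q ∈ G with t < (a Q).toReal, μ Q) * ENNReal.ofReal (t ^ (p - 1)) := by
        rw [Finset.sum_congr rfl hterm, ← Finset.mul_sum, ← lintegral_finsetSum]
        · simp_rw [Finset.sum_filter, Finset.sum_mul]
        · intro Q _
          refine Measurable.mul (Measurable.ite measurableSet_Iio measurable_const measurable_const)
            (by fun_prop)
    _ ≤ ENNReal.ofReal p * ∫⁻ t in Set.Ioi (0 : ℝ), Λ * (ENNReal.ofReal 2 * φ t) := by
        gcongr ENNReal.ofReal p * ?_
        refine setLIntegral_mono' measurableSet_Ioi fun t ht => ?_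
        have ht : 0 < t := ht
        have hsub : (G.filter fun Q => t < (a Q).toReal) ⊆ G := Finset.filter_subset _ _
        have := (hG.subset hsub).sum_le_of_packing (fun Q hQ => hmeas Q (hsub hQ)) μ
          (κ.restrict {x | t < 2 * g x}) (fun Q => μ Q) (Λ := Λ) (B := ENNReal.ofReal (2 / t)) ?_ ?_
        · refine (mul_le_mul_left this _).trans_eq ?_
          rw [Measure.restrict_apply_univ, hφ]
          have : ENNReal.ofReal (2 / t) * ENNReal.ofReal (t ^ (p - 1)) =
              ENNReal.ofReal 2 * ENNReal.ofReal (t ^ (p - 1 - 1)) := by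
            rw [← ENNReal.ofReal_mul (by positivity), ← ENNReal.ofReal_mul (by positivity),
              Real.rpow_sub_one ht.ne' (p - 1)]
            congr 1; ring
          calc _ = Λ * ((ENNReal.ofReal (2 / t) * ENNReal.ofReal (t ^ (p - 1))) *
                κ {x | t < 2 * g x}) := by ring
            _ = _ := by rw [this]; ring
        · intro R hR
          refine le_trans ?_ (hpack R (hsub hR))
          exact Finset.sum_le_sum_of_subset (Finset.filter_subset_filter _ hsub)
        · intro R hR
          have hR' := Finset.mem_filter.1 hR
          refine measure_le_of_lt_average μ hg (hmeas R hR'.1) (htop R hR'.1) ht ?_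
          have h3 : ENNReal.ofReal t ≤ a R :=
            (ENNReal.ofReal_le_iff_le_toReal (hatop R hR'.1)).2 hR'.2.le
          calc ENNReal.ofReal t * μ R ≤ a R * μ R := by gcongr
            _ ≤ _ := (ENNReal.div_mul_cancel (h0 R hR'.1) (htop R hR'.1)).le
    _ = _ := by
        rw [lintegral_const_mul _ (hφm.const_mul _), lintegral_const_mul _ hφm, hlayer]
        rw [ENNReal.ofReal_mul (p := p) (by linarith), ENNReal.ofReal_mul (p := 2) (by norm_num)]
        ring

/-! ### Sparse families: packing, and sparseness of principal sets. -/

open scoped Classical in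
/-- In a sparse laminar family, sums of measures are controlled by an integral of any function
dominating the averages. -/
theorem Laminar.packing_of_sparse {X : Type*} [MeasurableSpace X] {S : Finset (Set X)}
    (hS : Laminar S) (hmeas : ∀ Q ∈ S, MeasurableSet Q) (μ κ : Measure X)
    (h0 : ∀ Q ∈ S, μ Q ≠ 0) (htop : ∀ Q ∈ S, μ Q ≠ ∞)
    (hsparse : ∀ R ∈ S, 2 * μ (⋃ T ∈ S, ⋃ (_ : T ⊂ R), T) ≤ μ R)
    {R : Set X} (Φ : X → ℝ≥0∞) (hΦ : ∀ Q ∈ S, Q ⊆ R → ∀ x ∈ Q, κ Q / μ Q ≤ Φ x) :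
    ∑ Q ∈ S with Q ⊆ R, κ Q ≤ 2 * ∫⁻ x in R, Φ x ∂μ := by
  classical
  -- The sets `Q \ U Q` are pairwise disjoint, and by sparseness each carries at least half the
  -- measure of `Q`.
  set U : Set X → Set X := fun Q => ⋃ T ∈ S, ⋃ (_ : T ⊂ Q), T with hU
  have hUm : ∀ Q, MeasurableSet (U Q) := fun Q =>
    Finset.measurableSet_biUnion _ fun T hT => MeasurableSet.iUnion fun _ => hmeas T hT
  have hUsub : ∀ Q, U Q ⊆ Q := fun Q => Set.iUnion₂_subset fun T _ => Set.iUnion_subset fun h => h.1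
  have hE : ∀ Q ∈ S, μ Q ≤ 2 * μ (Q \ U Q) := by
    intro Q hQ
    have h1 : 2 * μ Q ≤ μ Q + 2 * μ (Q \ U Q) := by
      calc 2 * μ Q ≤ 2 * (μ (U Q) + μ (Q \ U Q)) := by
            gcongr
            calc μ Q ≤ μ (U Q ∪ (Q \ U Q)) := measure_mono (by simp)
              _ ≤ _ := measure_union_le _ _
        _ = 2 * μ (U Q) + 2 * μ (Q \ U Q) := mul_add _ _ _
        _ ≤ _ := by gcongr; exact hsparse Q hQ
    rw [two_mul] at h1
    exact (ENNReal.add_le_add_iff_left (htop Q hQ)).1 h1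
  have hdisj : ((S.filter (· ⊆ R) : Finset (Set X)) : Set (Set X)).PairwiseDisjoint
      fun Q => Q \ U Q := by
    intro Q hQ T hT hne
    simp only [Finset.coe_filter, Set.mem_ofPred_eq] at hQ hT
    have key : ∀ A ∈ S, ∀ B, A ⊆ B → A ≠ B → Disjoint (A \ U A) (B \ U B) := by
      intro A hA B hAB hne
      refine Set.disjoint_left.2 fun x hx hx' => hx'.2 ?_
      exact Set.mem_iUnion₂.2 ⟨A, hA, Set.mem_iUnion.2 ⟨hAB.ssubset_of_ne hne, hx.1⟩⟩
    rcases hS Q hQ.1 T hT.1 with h | h | h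
    · exact key Q hQ.1 T h hne
    · exact (key T hT.1 Q h hne.symm).symm
    · exact h.mono Set.sdiff_subset Set.sdiff_subset
  calc ∑ Q ∈ S with Q ⊆ R, κ Q ≤ ∑ Q ∈ S with Q ⊆ R, 2 * ∫⁻ x in Q \ U Q, Φ x ∂μ := by
        refine Finset.sum_le_sum fun Q hQ => ?_
        obtain ⟨hQ, hQR⟩ := Finset.mem_filter.1 hQ
        calc κ Q = κ Q / μ Q * μ Q := (ENNReal.div_mul_cancel (h0 Q hQ) (htop Q hQ)).symm
          _ ≤ κ Q / μ Q * (2 * μ (Q \ U Q)) := by gcongr; exact hE Q hQ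
          _ = 2 * ∫⁻ x in Q \ U Q, κ Q / μ Q ∂μ := by rw [setLIntegral_const]; ring
          _ ≤ _ := by
            gcongr 2 * ?_
            exact setLIntegral_mono' ((hmeas Q hQ).diff (hUm Q)) fun x hx => hΦ Q hQ hQR x hx.1
    _ = 2 * ∫⁻ x in ⋃ Q ∈ S.filter (· ⊆ R), Q \ U Q, Φ x ∂μ := by
        rw [lintegral_biUnion_finset hdisj
          fun Q hQ => (hmeas Q (Finset.mem_filter.1 hQ).1).diff (hUm Q), Finset.mul_sum]
    _ ≤ _ := by
        gcongr 2 * ?_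
        refine lintegral_mono_set ?_
        exact Set.iUnion₂_subset fun Q hQ => Set.sdiff_subset.trans (Finset.mem_filter.1 hQ).2

/-- Hölder's inequality for finite sums of products. -/
theorem sum_prod_rpow_le {ι κ : Type*} (s : Finset κ) (t : Finset ι) (f : ι → κ → ℝ≥0∞)
    {w : ι → ℝ} (hw : ∑ i ∈ t, w i = 1) (hw0 : ∀ i ∈ t, 0 ≤ w i) :
    ∑ k ∈ s, ∏ i ∈ t, f i k ^ w i ≤ ∏ i ∈ t, (∑ k ∈ s, f i k) ^ w i := by
  let _ : MeasurableSpace s := ⊤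
  have := ENNReal.lintegral_prod_norm_pow_le (μ := (Measure.count : Measure s)) t
    (f := fun i k => f i k) (fun i _ => (measurable_from_top).aemeasurable) hw hw0
  simp only [lintegral_count, tsum_fintype, Finset.univ_eq_attach] at this
  rw [Finset.sum_attach s fun k => ∏ i ∈ t, f i k ^ w i] at this
  refine this.trans_eq (Finset.prod_congr rfl fun i _ => ?_)
  rw [Finset.sum_attach s fun k => f i k]

theorem sum_rpow_le_rpow_sum {κ : Type*} (s : Finset κ) (f : κ → ℝ≥0∞) {r : ℝ} (hr : 1 ≤ r) :
    ∑ k ∈ s, f k ^ r ≤ (∑ k ∈ s, f k) ^ r := by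
  classical
  induction s using Finset.induction_on with
  | empty => simp
  | insert a s ha ih =>
    rw [Finset.sum_insert ha, Finset.sum_insert ha]
    exact (add_le_add_right ih _).trans (ENNReal.add_rpow_le_rpow_add _ _ hr)

/-- With `u = a / b ≤ 1`, the jump hypothesis gives `∏ k i / l i ≥ 2 ^ m * u ^ (θ * m) ≥ (2 * u) ^
m`, as `θ ≤ 1`; then take the `m`-th root. It turns a jump of `F` from `R` to `T` into a bound for
`μ T` that can be summed over disjoint `T`. -/
theorem prod_rpow_ratio_ge {m : ℕ} (hm : 0 < m) {θ : ℝ} (hθ0 : 0 ≤ θ) (hθ1 : θ ≤ 1)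
    {a b : ℝ≥0∞} (hab : a ≤ b) (hb : b ≠ 0) (hb' : b ≠ ∞) (ha : a ≠ 0) (k l : Fin m → ℝ≥0∞)
    (hl : ∀ i, l i ≠ ∞) (h : 2 ^ m * ∏ i, l i / b ^ θ < ∏ i, k i / a ^ θ)
    (hkl : ∀ i, k i ≤ l i) :
    2 * a ≤ b * ∏ i, (k i / l i) ^ (1 / (m : ℝ)) := by
  have ha' : a ≠ ∞ := ne_top_of_le_ne_top hb' hab
  have hl0 : ∀ i, l i ≠ 0 := by
    intro i hi
    have hk : k i = 0 := le_antisymm ((hkl i).trans hi.le) zero_le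
    rw [Finset.prod_eq_zero (f := fun i => k i / a ^ θ) (Finset.mem_univ i) (by simp [hk])] at h
    exact not_lt_zero h
  have hbθ : b ^ θ ≠ 0 := by simp [ENNReal.rpow_eq_zero_iff, hb, hb']
  have hbθ' : b ^ θ ≠ ∞ := ENNReal.rpow_ne_top_of_nonneg hθ0 hb'
  have haθ : a ^ θ ≠ 0 := by simp [ENNReal.rpow_eq_zero_iff, ha, ha']
  have haθ' : a ^ θ ≠ ∞ := ENNReal.rpow_ne_top_of_nonneg hθ0 ha'
  set u : ℝ≥0∞ := a / b
  have hu : u ≤ 1 := ENNReal.div_le_of_le_mul (by simpa using hab)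
  have key : ∀ i, k i / a ^ θ * u ^ θ = k i / l i * (l i / b ^ θ) := by
    intro i
    rw [ENNReal.div_rpow_of_nonneg _ _ hθ0]
    calc k i / a ^ θ * (a ^ θ / b ^ θ) = (k i / a ^ θ * a ^ θ) / b ^ θ := by
          rw [mul_div_assoc]
      _ = (k i / l i * l i) / b ^ θ := by
          rw [ENNReal.div_mul_cancel haθ haθ', ENNReal.div_mul_cancel (hl0 i) (hl i)]
      _ = _ := by rw [mul_div_assoc]
  have hx0 : ∏ i, l i / b ^ θ ≠ 0 :=
    Finset.prod_ne_zero_iff.2 fun i _ => ENNReal.div_ne_zero.2 ⟨hl0 i, hbθ'⟩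
  have hx1 : ∏ i, l i / b ^ θ ≠ ∞ := ENNReal.prod_ne_top fun i _ => ENNReal.div_ne_top (hl i) hbθ
  have h2 : (2 * u) ^ m ≤ ∏ i, k i / l i := by
    refine (ENNReal.mul_le_mul_iff_left hx0 hx1).1 ?_
    rw [← Finset.prod_mul_distrib, ← Finset.prod_congr rfl fun i _ => key i,
      Finset.prod_mul_distrib, Finset.prod_const, Finset.card_univ, Fintype.card_fin, mul_pow]
    calc 2 ^ m * u ^ m * ∏ i, l i / b ^ θ = 2 ^ m * (∏ i, l i / b ^ θ) * u ^ m := by ring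
      _ ≤ (∏ i, k i / a ^ θ) * (u ^ θ) ^ m := by
        refine mul_le_mul' h.le (pow_le_pow_left' ?_ m)
        simpa using ENNReal.rpow_le_rpow_of_exponent_ge hu hθ1
  have h3 : 2 * u ≤ ∏ i, (k i / l i) ^ (1 / (m : ℝ)) := by
    rw [ENNReal.prod_rpow_of_nonneg (by positivity)]
    refine le_trans (le_of_eq ?_) (ENNReal.rpow_le_rpow h2 (by positivity))
    rw [← ENNReal.rpow_natCast, ← ENNReal.rpow_mul, mul_one_div_cancel (by positivity),
      ENNReal.rpow_one]
  calc 2 * a = b * (2 * u) := by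
        rw [mul_left_comm, ENNReal.mul_div_cancel hb hb']
    _ ≤ _ := by gcongr

/-- Principal sets for a product of fractional averages form a sparse family. -/
theorem Laminar.sparse_of_principal {X : Type*} [MeasurableSpace X] {S : Finset (Set X)}
    (hS : Laminar S) (hmeas : ∀ Q ∈ S, MeasurableSet Q) (μ : Measure X)
    (h0 : ∀ Q ∈ S, μ Q ≠ 0) (htop : ∀ Q ∈ S, μ Q ≠ ∞) {m : ℕ} (hm : 0 < m)
    (κ : Fin m → Measure X) (hκ : ∀ i, ∀ Q ∈ S, κ i Q ≠ ∞) {θ : ℝ} (hθ0 : 0 ≤ θ) (hθ1 : θ ≤ 1)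
    (hF : ∀ T ∈ S, ∀ R ∈ S, T ⊂ R → 2 ^ m * ∏ i, κ i R / μ R ^ θ < ∏ i, κ i T / μ T ^ θ) :
    ∀ R ∈ S, 2 * μ (⋃ T ∈ S, ⋃ (_ : T ⊂ R), T) ≤ μ R := by
  classical
  intro R hR
  obtain ⟨H, hHS, hdisj, hcov⟩ :=
    (hS.subset (Finset.filter_subset (· ⊂ R) S)).exists_disjoint_cover
  have hH : ∀ T ∈ H, T ∈ S ∧ T ⊂ R := fun T hT => Finset.mem_filter.1 (hHS hT)
  have hm' : (0 : ℝ) < m := by exact_mod_cast hm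
  calc 2 * μ (⋃ T ∈ S, ⋃ (_ : T ⊂ R), T) ≤ 2 * μ (⋃ T ∈ H, T) := by
        gcongr 2 * μ ?_
        refine Set.iUnion₂_subset fun T hT => Set.iUnion_subset fun hTR => ?_
        obtain ⟨T', hT', hsub⟩ := hcov T (Finset.mem_filter.2 ⟨hT, hTR⟩)
        exact hsub.trans (Set.subset_biUnion_of_mem (u := fun T => T) hT')
    _ ≤ 2 * ∑ T ∈ H, μ T := by gcongr; exact measure_biUnion_finset_le _ _
    _ ≤ ∑ T ∈ H, μ R * ∏ i, (κ i T / κ i R) ^ (1 / (m : ℝ)) := by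
        rw [Finset.mul_sum]
        refine Finset.sum_le_sum fun T hT => ?_
        obtain ⟨hTS, hTR⟩ := hH T hT
        exact prod_rpow_ratio_ge hm hθ0 hθ1 (measure_mono hTR.le) (h0 R hR) (htop R hR) (h0 T hTS)
          _ _ (fun i => hκ i R hR) (hF T hTS R hR hTR) fun i => measure_mono hTR.le
    -- Hölder with `m` exponents `1 / m`; each inner sum is at most one because the sets `T` are
    -- disjoint subsets of `R`.
    _ ≤ μ R * ∏ i, (∑ T ∈ H, κ i T / κ i R) ^ (1 / (m : ℝ)) := by
        rw [← Finset.mul_sum]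
        gcongr
        refine sum_prod_rpow_le H Finset.univ (fun i T => κ i T / κ i R) ?_ fun _ _ => by positivity
        simp [hm'.ne']
    _ ≤ μ R * 1 := by
        gcongr
        refine Finset.prod_le_one' fun i _ => ENNReal.rpow_le_one ?_ (by positivity)
        simp_rw [div_eq_mul_inv]
        rw [← Finset.sum_mul, ← div_eq_mul_inv]
        refine ENNReal.div_le_of_le_mul ?_
        rw [one_mul, ← measure_biUnion_finset (f := fun T => T) hdisj fun T hT => hmeas T (hH T hT).1]
        exact measure_mono (Set.iUnion₂_subset fun T hT => (hH T hT).2.le)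
    _ = μ R := mul_one _

/-! ### The weighted estimate for a finite laminar family. -/

/-- Since `q / P i + q / (P i).conjExponent = q`, the factor `s i ^ q` splits into a part kept for
the Carleson embedding and a part that the weight condition `hK` absorbs together with `v` and the
powers of `u`. -/
theorem prod_average_rpow_mul_le {m : ℕ} {P : Fin m → ℝ} (hP : ∀ i, 1 < P i) {q θ : ℝ}
    (hq : 0 < q) (hθ0 : 0 ≤ θ) {u v K : ℝ≥0∞} (hu : u ≠ 0) (hu' : u ≠ ∞) (k s : Fin m → ℝ≥0∞)
    (hs : ∀ i, s i ≠ 0) (hs' : ∀ i, s i ≠ ∞)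
    (hK : v * ∏ i, s i ^ (q / (P i).conjExponent) ≤ K * u ^ (m * q * θ)) :
    (∏ i, k i / u ^ θ) ^ q * v ≤ K * ∏ i, ((k i / s i) ^ P i * s i) ^ (q / P i) := by
  have huθ : u ^ (m * q * θ) ≠ 0 := by simp [ENNReal.rpow_eq_zero_iff, hu, hu']
  have huθ' : u ^ (m * q * θ) ≠ ∞ := ENNReal.rpow_ne_top_of_nonneg (by positivity) hu'
  have hterm : ∀ i, (k i / u ^ θ) ^ q =
      ((k i / s i) ^ P i * s i) ^ (q / P i) * s i ^ (q / (P i).conjExponent) * (u ^ (-(q * θ))) := by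
    intro i
    have hPi : 0 < P i := by linarith [hP i]
    have hPi' : 0 < (P i).conjExponent := (Real.HolderConjugate.conjExponent (hP i)).symm.pos
    have hsum : q / P i + q / (P i).conjExponent = q := by
      have := (Real.HolderConjugate.conjExponent (hP i)).inv_add_inv_eq_one
      rw [div_eq_mul_inv, div_eq_mul_inv, ← mul_add, this, mul_one]
    rw [ENNReal.mul_rpow_of_nonneg _ _ (by positivity), ← ENNReal.rpow_mul,
      mul_div_cancel₀ _ hPi.ne', mul_assoc (_ ^ q), ← ENNReal.rpow_add_of_nonneg _ _ (by positivity)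
      (by positivity), hsum, ← ENNReal.mul_rpow_of_nonneg _ _ hq.le,
      ENNReal.div_mul_cancel (hs i) (hs' i), ENNReal.div_rpow_of_nonneg _ _ hq.le,
      ← ENNReal.rpow_mul, ENNReal.rpow_neg, div_eq_mul_inv, mul_comm θ q]
  rw [← ENNReal.prod_rpow_of_nonneg hq.le, Finset.prod_congr rfl fun i _ => hterm i,
    Finset.prod_mul_distrib, Finset.prod_mul_distrib, Finset.prod_const, Finset.card_univ,
    Fintype.card_fin, ← ENNReal.rpow_natCast, ← ENNReal.rpow_mul,
    show -(q * θ) * (m : ℝ) = -(m * q * θ) by ring, ENNReal.rpow_neg]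
  set D := ∏ i, ((k i / s i) ^ P i * s i) ^ (q / P i)
  calc D * (∏ i, s i ^ (q / (P i).conjExponent)) * (u ^ (m * q * θ))⁻¹ * v
      = D * (v * ∏ i, s i ^ (q / (P i).conjExponent)) * (u ^ (m * q * θ))⁻¹ := by ring
    _ ≤ D * (K * u ^ (m * q * θ)) * (u ^ (m * q * θ))⁻¹ := by gcongr
    _ = K * D * (u ^ (m * q * θ) * (u ^ (m * q * θ))⁻¹) := by ring
    _ = K * D := by rw [ENNReal.mul_inv_cancel huθ huθ', mul_one]

/-- The constant in the Carleson embedding theorem. -/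
noncomputable def carlesonConst (p : ℝ) : ℝ := p * (2 * (2 ^ (p - 1) / (p - 1)))

/-- The weighted estimate for the maximal operator of a finite laminar family. -/
theorem Laminar.lintegral_iSup_le {X : Type*} [MeasurableSpace X] {G : Finset (Set X)}
    (hG : Laminar G) (hmeas : ∀ Q ∈ G, MeasurableSet Q) (μ ν : Measure X)
    (h0 : ∀ Q ∈ G, μ Q ≠ 0) (htop : ∀ Q ∈ G, μ Q ≠ ∞) {m : ℕ} (hm : 0 < m)
    (κ σ : Fin m → Measure X) (hκ : ∀ i, ∀ Q ∈ G, κ i Q ≠ ∞)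
    (hσ0 : ∀ i, ∀ Q ∈ G, σ i Q ≠ 0) (hσ : ∀ i, ∀ Q ∈ G, σ i Q ≠ ∞)
    {g : Fin m → X → ℝ} (hg : ∀ i, Measurable (g i)) (hg0 : ∀ i x, 0 ≤ g i x)
    (hκg : ∀ i, ∀ Q ∈ G, κ i Q = ∫⁻ x in Q, ENNReal.ofReal (g i x) ∂σ i)
    {P : Fin m → ℝ} (hP : ∀ i, 1 < P i) {p q θ : ℝ} (hp : 1 / p = ∑ i, 1 / P i) (hp0 : 0 < p)
    (hpq : p ≤ q) (hθ0 : 0 ≤ θ) (hθ1 : θ ≤ 1) {K : ℝ≥0∞}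
    (hK : ∀ Q ∈ G, ν Q * ∏ i, σ i Q ^ (q / (P i).conjExponent) ≤ K * μ Q ^ (m * q * θ))
    {L : Fin m → ℝ≥0∞}
    (hL : ∀ i, ∀ R ∈ G, ∃ Φ : X → ℝ≥0∞,
      (∀ Q ∈ G, Q ⊆ R → ∀ x ∈ Q, σ i Q / μ Q ≤ Φ x) ∧ ∫⁻ x in R, Φ x ∂μ ≤ L i * σ i R) :
    ∫⁻ x, (⨆ Q ∈ G, Q.indicator (fun _ => (∏ i, κ i Q / μ Q ^ θ) ^ q) x) ∂ν ≤
      (2 ^ m) ^ q * K * ∏ i, (ENNReal.ofReal (carlesonConst (P i)) * (2 * L i) *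
        ∫⁻ x, ENNReal.ofReal (g i x) ^ P i ∂σ i) ^ (q / P i) := by
  classical
  have hq : 0 < q := hp0.trans_le hpq
  set F : Set X → ℝ≥0∞ := fun Q => ∏ i, κ i Q / μ Q ^ θ with hFdef
  -- The jump `2 ^ m` is chosen so that its `m`-th root is the factor `2` of sparseness.
  obtain ⟨S, hSG, hcov, hprin⟩ := exists_principal F (A := 2 ^ m) (one_le_pow₀ (by norm_num)) G
  have hS := hG.subset hSG
  have hsparse := hS.sparse_of_principal (fun Q hQ => hmeas Q (hSG hQ)) μ (fun Q hQ => h0 Q (hSG hQ))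
    (fun Q hQ => htop Q (hSG hQ)) hm κ (fun i Q hQ => hκ i Q (hSG hQ)) hθ0 hθ1 hprin
  set b : Fin m → Set X → ℝ≥0∞ := fun i Q => (κ i Q / σ i Q) ^ P i * σ i Q with hb
  have hemb : ∀ i, ∑ Q ∈ S, b i Q ≤ ENNReal.ofReal (carlesonConst (P i)) * (2 * L i) *
        ∫⁻ x, ENNReal.ofReal (g i x) ^ P i ∂σ i := by
    intro i
    have := hS.carleson_embedding (fun Q hQ => hmeas Q (hSG hQ)) (σ i)
      (fun Q hQ => hσ0 i Q (hSG hQ)) (fun Q hQ => hσ i Q (hSG hQ)) (Λ := 2 * L i) ?_ (hg i)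
      (hg0 i) (fun Q hQ => by rw [← hκg i Q (hSG hQ)]; exact hκ i Q (hSG hQ)) (hP i)
    · refine le_trans (le_of_eq (Finset.sum_congr rfl fun Q hQ => ?_)) this
      rw [hb, ← hκg i Q (hSG hQ)]
    · intro R hR
      obtain ⟨Φ, hΦ, hΦR⟩ := hL i R (hSG hR)
      refine (hS.packing_of_sparse (fun Q hQ => hmeas Q (hSG hQ)) μ (σ i)
        (fun Q hQ => h0 Q (hSG hQ)) (fun Q hQ => htop Q (hSG hQ)) hsparse Φ
        fun Q hQ => hΦ Q (hSG hQ)).trans ?_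
      rw [mul_assoc]
      gcongr
  calc ∫⁻ x, (⨆ Q ∈ G, Q.indicator (fun _ => F Q ^ q) x) ∂ν
      ≤ ∫⁻ x, ∑ R ∈ S, R.indicator (fun _ => (2 ^ m) ^ q * F R ^ q) x ∂ν := by
        refine lintegral_mono fun x => iSup₂_le fun Q hQ => ?_
        by_cases hx : x ∈ Q
        · obtain ⟨R, hR, hQR, hle⟩ := hcov Q hQ
          rw [Set.indicator_of_mem hx]
          refine le_trans ?_ (Finset.single_le_sum
            (f := fun R => R.indicator (fun _ => (2 ^ m) ^ q * F R ^ q) x)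
            (fun _ _ => zero_le) hR)
          simp only [Set.indicator_of_mem (hQR hx)]
          rw [← ENNReal.mul_rpow_of_nonneg _ _ hq.le]
          gcongr
        · simp [hx]
    _ = (2 ^ m) ^ q * ∑ R ∈ S, F R ^ q * ν R := by
        rw [lintegral_finsetSum _ fun R hR => measurable_const.indicator (hmeas R (hSG hR)),
          Finset.mul_sum]
        refine Finset.sum_congr rfl fun R hR => ?_
        rw [lintegral_indicator_const (hmeas R (hSG hR)), mul_assoc]
    _ ≤ (2 ^ m) ^ q * ∑ R ∈ S, K * ∏ i, b i R ^ (q / P i) := by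
        refine mul_le_mul_right (Finset.sum_le_sum fun R hR => ?_) _
        exact prod_average_rpow_mul_le hP hq hθ0 (h0 R (hSG hR)) (htop R (hSG hR)) _ _
          (fun i => hσ0 i R (hSG hR)) (fun i => hσ i R (hSG hR)) (hK R (hSG hR))
    -- The exponents `p / P i` sum to one, as Hölder requires; the outer exponent `q / p ≥ 1` is
    -- pulled out of the sum by superadditivity.
    _ = (2 ^ m) ^ q * K * ∑ R ∈ S, (∏ i, b i R ^ (p / P i)) ^ (q / p) := by
        rw [← Finset.mul_sum, mul_assoc]
        congr 2
        refine Finset.sum_congr rfl fun R _ => ?_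
        rw [← ENNReal.prod_rpow_of_nonneg (by positivity)]
        refine Finset.prod_congr rfl fun i _ => ?_
        rw [← ENNReal.rpow_mul]
        congr 1
        field_simp
    _ ≤ (2 ^ m) ^ q * K * (∏ i, (∑ R ∈ S, b i R) ^ (p / P i)) ^ (q / p) := by
        gcongr
        refine (sum_rpow_le_rpow_sum S _ ((one_le_div hp0).2 hpq)).trans ?_
        gcongr
        refine sum_prod_rpow_le S Finset.univ b ?_ fun i _ => ?_
        · have : ∑ i, p / P i = p * ∑ i, 1 / P i := by
            rw [Finset.mul_sum]; exact Finset.sum_congr rfl fun i _ => by ring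
          rw [this, ← hp]; field_simp
        · have := hP i; positivity
    _ ≤ _ := by
        rw [← ENNReal.prod_rpow_of_nonneg (by positivity)]
        gcongr with i
        rw [← ENNReal.rpow_mul]
        have h1 : p / P i * (q / p) = q / P i := by field_simp
        have := hP i
        rw [h1]
        exact ENNReal.rpow_le_rpow (hemb i) (by positivity)

/-! ### Dyadic grids and the one-third trick. -/

/-- The offset, relative to the side length, of the `k`-th generation of a one-dimensional dyadic
grid (the standard one or the one shifted by a third). -/
noncomputable def gridOffset (b : Bool) (k : ℤ) : ℝ := if b then (-1) ^ k / 3 else 0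

/-- The index of the cube of side `2 ^ k` of the grid `β` which contains `x`. -/
noncomputable def gridIndex {n : ℕ} (β : Fin n → Bool) (k : ℤ) (x : Fin n → ℝ) : Fin n → ℤ :=
  fun j => ⌊x j / 2 ^ k - gridOffset (β j) k⌋

/-- The dyadic cubes of the grid `β`. -/
def gridCube {n : ℕ} (β : Fin n → Bool) (r : ℤ × (Fin n → ℤ)) : Set (Fin n → ℝ) :=
  {x | gridIndex β r.1 x = r.2}

/-- The lower left vertex of a dyadic cube. -/
noncomputable def gridCorner {n : ℕ} (β : Fin n → Bool) (r : ℤ × (Fin n → ℤ)) : Fin n → ℝ :=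
  fun j => 2 ^ r.1 * (r.2 j + gridOffset (β j) r.1)

theorem gridCube_eq {n : ℕ} (β : Fin n → Bool) (r : ℤ × (Fin n → ℤ)) :
    gridCube β r =
      Set.univ.pi fun j => Set.Ico (gridCorner β r j) (gridCorner β r j + 2 ^ r.1) := by
  ext x
  have h2 : (0 : ℝ) < 2 ^ r.1 := by positivity
  simp only [gridCube, Set.mem_ofPred_eq, funext_iff, gridIndex, Set.mem_pi, Set.mem_univ,
    true_imp_iff, Set.mem_Ico, Int.floor_eq_iff, gridCorner]
  refine forall_congr' fun j => and_congr ?_ ?_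
  · rw [le_sub_iff_add_le, le_div_iff₀ h2, mul_comm]
  · rw [sub_lt_iff_lt_add, div_lt_iff₀ h2]
    ring_nf

theorem measurableSet_gridCube {n : ℕ} (β : Fin n → Bool) (r : ℤ × (Fin n → ℤ)) :
    MeasurableSet (gridCube β r) := by
  rw [gridCube_eq]
  exact MeasurableSet.univ_pi fun j => measurableSet_Ico

/-- The closed cube with the same vertices as a dyadic cube. -/
def closedGridCube {n : ℕ} (β : Fin n → Bool) (r : ℤ × (Fin n → ℤ)) : Set (Fin n → ℝ) :=
  Set.Icc (gridCorner β r) fun j => gridCorner β r j + 2 ^ r.1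

theorem isCube_closedGridCube {n : ℕ} (β : Fin n → Bool) (r : ℤ × (Fin n → ℤ)) :
    IsCube (closedGridCube β r) :=
  ⟨_, 2 ^ r.1, by positivity, rfl⟩

theorem gridCube_ae_eq {n : ℕ} (β : Fin n → Bool) (r : ℤ × (Fin n → ℤ)) :
    gridCube β r =ᵐ[volume] closedGridCube β r := by
  rw [gridCube_eq]
  exact Measure.univ_pi_Ico_ae_eq_Icc

theorem gridCube_subset {n : ℕ} (β : Fin n → Bool) (r : ℤ × (Fin n → ℤ)) :
    gridCube β r ⊆ closedGridCube β r := by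
  rw [gridCube_eq]
  exact fun x hx => ⟨fun j => (hx j trivial).1, fun j => (hx j trivial).2.le⟩

theorem volume_cube {n : ℕ} (a : Fin n → ℝ) (l : ℝ) :
    volume (Set.Icc a fun j => a j + l) = ENNReal.ofReal l ^ n := by
  rw [Real.volume_Icc_pi]
  simp

theorem volume_gridCube {n : ℕ} (β : Fin n → Bool) (r : ℤ × (Fin n → ℤ)) :
    volume (gridCube β r) = ENNReal.ofReal (2 ^ r.1) ^ n := by
  rw [measure_congr (gridCube_ae_eq β r), closedGridCube, volume_cube]

/-- The alternating sign makes the shifted grids nested: `2 * (-1) ^ (k + 1) / 3` and `(-1) ^ k / 3`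
differ by `(-1) ^ k`, an integer. -/
theorem gridOffset_succ (b : Bool) (k : ℤ) :
    ∃ z : ℤ, 2 * gridOffset b (k + 1) = gridOffset b k - z := by
  cases b
  · exact ⟨0, by simp [gridOffset]⟩
  · refine ⟨if Even k then 1 else -1, ?_⟩
    simp only [gridOffset, if_true, zpow_add_one₀ (show (-1 : ℝ) ≠ 0 by norm_num)]
    rcases Int.even_or_odd k with h | h
    · simp [h.neg_one_zpow, h]; norm_num
    · simp [h.neg_one_zpow, Int.not_even_iff_odd.2 h]; norm_num

/-- Up to an integer translation, passing to the next generation halves the coordinate, and the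
floor of `y / 2` depends only on the floor of `y`. -/
theorem gridIndex_succ {n : ℕ} (β : Fin n → Bool) (k : ℤ) {x y : Fin n → ℝ}
    (h : gridIndex β k x = gridIndex β k y) : gridIndex β (k + 1) x = gridIndex β (k + 1) y := by
  funext j
  obtain ⟨z, hz⟩ := gridOffset_succ (β j) k
  have key : ∀ x : Fin n → ℝ, gridIndex β (k + 1) x j = (gridIndex β k x j + z) / 2 := by
    intro x
    have := Int.floor_div_natCast (x j / 2 ^ k - gridOffset (β j) k + z) 2
    rw [Int.floor_add_intCast] at this
    simp only [gridIndex]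
    refine Eq.trans ?_ this
    congr 1
    rw [zpow_add_one₀ (by norm_num)]
    have h2 : (0 : ℝ) < 2 ^ k := by positivity
    have : gridOffset (β j) (k + 1) = (gridOffset (β j) k - z) / 2 := by linarith
    rw [this]
    push_cast
    field_simp
    ring
  rw [key, key, h]

theorem gridIndex_mono {n : ℕ} (β : Fin n → Bool) {k l : ℤ} (hkl : k ≤ l) {x y : Fin n → ℝ}
    (h : gridIndex β k x = gridIndex β k y) : gridIndex β l x = gridIndex β l y := by
  induction l, hkl using Int.leInduction with
  | base => exact h
  | succ l _ ih => exact gridIndex_succ β l ih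

theorem gridCube_nested {n : ℕ} (β : Fin n → Bool) (r s : ℤ × (Fin n → ℤ)) :
    gridCube β r ⊆ gridCube β s ∨ gridCube β s ⊆ gridCube β r ∨
      Disjoint (gridCube β r) (gridCube β s) := by
  have key : ∀ r s : ℤ × (Fin n → ℤ), r.1 ≤ s.1 →
      gridCube β r ⊆ gridCube β s ∨ Disjoint (gridCube β r) (gridCube β s) := by
    intro r s hrs
    rw [or_iff_not_imp_right, Set.not_disjoint_iff]
    rintro ⟨x, hxr, hxs⟩ y hy
    exact (gridIndex_mono β hrs (Eq.trans hy (Eq.symm hxr))).trans hxs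
  rcases le_total r.1 s.1 with h | h
  · exact (key r s h).imp_right Or.inr
  · exact Or.inr ((key s r h).imp_right fun h => h.symm)

/-- The one-third trick in dimension one. -/
theorem exists_gridOffset (u : ℝ) (k : ℤ) :
    ∃ b, ∀ v, u ≤ v → v < u + 1 / 3 → ⌊v - gridOffset b k⌋ = ⌊u - gridOffset b k⌋ := by
  by_cases h : u + 1 / 3 ≤ ⌊u⌋ + 1
  · refine ⟨false, fun v h1 h2 => ?_⟩
    have := Int.floor_le u
    simp only [gridOffset, Bool.false_eq_true, if_false, sub_zero]
    exact Int.floor_eq_iff.2 ⟨by linarith, by linarith⟩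
  -- Here the fractional part of `u` exceeds `2 / 3`, so a shift by `1 / 3` in either direction
  -- moves the whole interval `[u, u + 1 / 3)` strictly between consecutive integers.
  · push Not at h
    have hu := Int.lt_floor_add_one u
    refine ⟨true, ?_⟩
    simp only [gridOffset, if_true]
    rcases Int.even_or_odd k with hk | hk
    · rw [hk.neg_one_zpow]
      have key : ∀ v, u ≤ v → v < u + 1 / 3 → ⌊v - 1 / 3⌋ = ⌊u⌋ := fun v h1 h2 =>
        Int.floor_eq_iff.2 ⟨by linarith, by linarith⟩
      exact fun v h1 h2 => (key v h1 h2).trans (key u le_rfl (by linarith)).symm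
    · rw [hk.neg_one_zpow]
      have key : ∀ v, u ≤ v → v < u + 1 / 3 → ⌊v - -1 / 3⌋ = ⌊u⌋ + 1 := fun v h1 h2 =>
        Int.floor_eq_iff.2 ⟨by push_cast; linarith, by push_cast; linarith⟩
      exact fun v h1 h2 => (key v h1 h2).trans (key u le_rfl (by linarith)).symm

/-- Every cube is contained in a dyadic cube of comparable size of one of the grids. -/
theorem exists_gridCube {n : ℕ} {Q : Set (Fin n → ℝ)} (hQ : IsCube Q) :
    ∃ (β : Fin n → Bool) (r : ℤ × (Fin n → ℤ)),
      Q ⊆ gridCube β r ∧ volume (gridCube β r) ≤ 6 ^ n * volume Q := by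
  obtain ⟨a, l, hl, rfl⟩ := hQ
  -- From `2 ^ k ≤ 3 * l < 2 ^ (k + 1)`: at scale `2 ^ (k + 1)` the cube has relative side below `1
  -- / 3`, and that scale is at most `6 * l`. The grid is chosen in each coordinate separately.
  obtain ⟨k, hk1, hk2⟩ := exists_mem_Ico_zpow (show 0 < 3 * l by positivity) one_lt_two
  have h2 : (0 : ℝ) < 2 ^ (k + 1) := by positivity
  choose β hβ using fun j => exists_gridOffset (a j / 2 ^ (k + 1)) (k + 1)
  refine ⟨β, (k + 1, gridIndex β (k + 1) a), fun x hx => ?_, ?_⟩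
  · funext j
    refine hβ j _ ?_ ?_
    · have := hx.1 j
      gcongr
    · have := hx.2 j
      simp only at this
      rw [div_lt_iff₀ h2, add_mul, div_mul_cancel₀ _ h2.ne']
      linarith
  · rw [volume_gridCube, volume_cube, ← mul_pow]
    gcongr
    rw [show (6 : ℝ≥0∞) = ENNReal.ofReal 6 by simp, ← ENNReal.ofReal_mul (by norm_num)]
    refine ENNReal.ofReal_le_ofReal ?_
    rw [zpow_add_one₀ (by norm_num)]
    linarith

/-! ### Reduction to finite families, and properties of the weights. -/

/-- To bound the integral of a countable supremum it suffices to treat finite suprema. -/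
theorem lintegral_iSup_le_of_finset {X ι : Type*} [MeasurableSpace X] [Countable ι] (ν : Measure X)
    {φ : ι → X → ℝ≥0∞} (hφ : ∀ i, Measurable (φ i)) {B : ℝ≥0∞}
    (h : ∀ s : Finset ι, ∫⁻ x, ⨆ i ∈ s, φ i x ∂ν ≤ B) : ∫⁻ x, ⨆ i, φ i x ∂ν ≤ B := by
  rw [lintegral_congr fun x => iSup_eq_iSup_finset fun i => φ i x, lintegral_iSup_directed]
  · exact iSup_le h
  · exact fun s => (Measurable.biSup _ s.countable_toSet fun i _ => hφ i).aemeasurable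
  · refine Monotone.directed_le fun s t hst x => ?_
    exact biSup_mono fun i hi => hst hi

theorem IsCube.volume_ne_zero {n : ℕ} {Q : Set (Fin n → ℝ)} (hQ : IsCube Q) : volume Q ≠ 0 := by
  obtain ⟨a, l, hl, rfl⟩ := hQ
  rw [volume_cube]
  exact pow_ne_zero _ (by simpa using hl)

theorem IsCube.volume_ne_top {n : ℕ} {Q : Set (Fin n → ℝ)} (hQ : IsCube Q) : volume Q ≠ ∞ := by
  obtain ⟨a, l, hl, rfl⟩ := hQ
  rw [volume_cube]
  exact ENNReal.pow_ne_top ENNReal.ofReal_ne_top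

theorem setLIntegral_gridCube {n : ℕ} (β : Fin n → Bool) (r : ℤ × (Fin n → ℤ))
    (h : (Fin n → ℝ) → ℝ≥0∞) :
    ∫⁻ x in gridCube β r, h x = ∫⁻ x in closedGridCube β r, h x :=
  setLIntegral_congr (gridCube_ae_eq β r)

theorem volume_gridCube_eq_closed {n : ℕ} (β : Fin n → Bool) (r : ℤ × (Fin n → ℤ)) :
    volume (gridCube β r) = volume (closedGridCube β r) :=
  measure_congr (gridCube_ae_eq β r)

theorem volume_gridCube_ne_zero {n : ℕ} (β : Fin n → Bool) (r : ℤ × (Fin n → ℤ)) :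
    volume (gridCube β r) ≠ 0 := by
  rw [volume_gridCube_eq_closed]
  exact (isCube_closedGridCube β r).volume_ne_zero

theorem volume_gridCube_ne_top {n : ℕ} (β : Fin n → Bool) (r : ℤ × (Fin n → ℤ)) :
    volume (gridCube β r) ≠ ∞ := by
  rw [volume_gridCube_eq_closed]
  exact (isCube_closedGridCube β r).volume_ne_top

theorem prod_rpow_eq_rpow_sum {ι : Type*} (s : Finset ι) (u : ℝ≥0∞) {e : ι → ℝ}
    (he : ∀ i, 0 ≤ e i) : ∏ i ∈ s, u ^ e i = u ^ ∑ i ∈ s, e i := by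
  classical
  induction s using Finset.induction_on with
  | empty => simp
  | insert a s ha ih =>
    rw [Finset.prod_insert ha, Finset.sum_insert ha, ih,
      ENNReal.rpow_add_of_nonneg _ _ (he a) (Finset.sum_nonneg fun i _ => he i)]

theorem mul_prod_rpow_le_of_average {m : ℕ} {u v K : ℝ≥0∞} (hu : u ≠ 0) (hu' : u ≠ ∞)
    (s : Fin m → ℝ≥0∞) {e : Fin m → ℝ} (he : ∀ i, 0 ≤ e i)
    (h : v / u * ∏ i, (s i / u) ^ e i ≤ K) :
    v * ∏ i, s i ^ e i ≤ K * u ^ (1 + ∑ i, e i) := by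
  have h1 : ∀ i, s i ^ e i = (s i / u) ^ e i * u ^ e i := fun i => by
    rw [← ENNReal.mul_rpow_of_nonneg _ _ (he i), ENNReal.div_mul_cancel hu hu']
  rw [Finset.prod_congr rfl fun i _ => h1 i, Finset.prod_mul_distrib,
    prod_rpow_eq_rpow_sum _ _ he,
    ENNReal.rpow_add_of_nonneg _ _ zero_le_one (Finset.sum_nonneg fun i _ => he i),
    ENNReal.rpow_one]
  calc v * ((∏ i, (s i / u) ^ e i) * u ^ ∑ i, e i)
      = v / u * u * ((∏ i, (s i / u) ^ e i) * u ^ ∑ i, e i) := by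
        rw [ENNReal.div_mul_cancel hu hu']
    _ = v / u * (∏ i, (s i / u) ^ e i) * (u * u ^ ∑ i, e i) := by ring
    _ ≤ _ := by gcongr

theorem le_aConst {n m : ℕ} (P : Fin m → ℝ) (q : ℝ) (ω : Fin m → (Fin n → ℝ) → ℝ≥0)
    {Q : Set (Fin n → ℝ)} (hQ : IsCube Q) :
    (⨍⁻ x in Q, prodWeight ω x ^ q ∂volume) *
      ∏ i, (⨍⁻ x in Q, dualWeight (P i) (ω i) x ∂volume) ^ (q / (P i).conjExponent) ≤
      aConst P q ω :=
  le_iSup₂_of_le (f := fun Q (_ : IsCube Q) => (⨍⁻ x in Q, prodWeight ω x ^ q ∂volume) *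
      ∏ i, (⨍⁻ x in Q, dualWeight (P i) (ω i) x ∂volume) ^ (q / (P i).conjExponent)) Q hQ le_rfl

theorem lintegral_hardyLittlewoodMaximal_le {n : ℕ} (σ : (Fin n → ℝ) → ℝ≥0∞)
    {Q : Set (Fin n → ℝ)} (hQ : IsCube Q) (h0 : ∫⁻ x in Q, σ x ≠ 0) (htop : ∫⁻ x in Q, σ x ≠ ∞) :
    ∫⁻ x in Q, hardyLittlewoodMaximal (Q.indicator σ) x ≤ aInftyConst σ * ∫⁻ x in Q, σ x := by
  rw [← ENNReal.div_le_iff h0 htop]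
  exact le_iSup₂_of_le (f := fun Q (_ : IsCube Q) =>
    (∫⁻ x in Q, hardyLittlewoodMaximal (Q.indicator σ) x) / ∫⁻ x in Q, σ x) Q hQ le_rfl

theorem dualWeight_ne_zero {n : ℕ} {p : ℝ} (hp : 1 < p) (w : (Fin n → ℝ) → ℝ≥0) (x : Fin n → ℝ) :
    dualWeight p w x ≠ 0 := by
  have : 0 < p.conjExponent := (Real.HolderConjugate.conjExponent hp).symm.pos
  simp only [dualWeight, ne_eq, ENNReal.rpow_eq_zero_iff, not_or, not_and]
  exact ⟨fun _ => by linarith, fun h => absurd h ENNReal.coe_ne_top⟩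

theorem aemeasurable_dualWeight {n : ℕ} (p : ℝ) {w : (Fin n → ℝ) → ℝ≥0} (hw : AEMeasurable w) :
    AEMeasurable (dualWeight p w) :=
  hw.coe_nnreal_ennreal.pow_const _

theorem setLIntegral_ne_zero_of_pos {X : Type*} [MeasurableSpace X] {μ : Measure X}
    {h : X → ℝ≥0∞} (hm : AEMeasurable h μ) (h0 : ∀ x, h x ≠ 0) {Q : Set X} (hQ : μ Q ≠ 0) :
    ∫⁻ x in Q, h x ∂μ ≠ 0 := by
  intro h1
  rw [lintegral_eq_zero_iff' hm.restrict] at h1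
  refine hQ ?_
  rw [← Measure.restrict_eq_zero, ← ae_eq_bot, ← Filter.eventually_false_iff_eq_bot]
  filter_upwards [h1] with x hx
  exact h0 x hx

theorem aemeasurable_prodWeight {n m : ℕ} {ω : Fin m → (Fin n → ℝ) → ℝ≥0}
    (hω : ∀ i, AEMeasurable (ω i)) : AEMeasurable (prodWeight ω) :=
  Finset.aemeasurable_fun_prod _ fun i _ => (hω i).coe_nnreal_ennreal

/-- Either the weight `ν_ω ^ q` vanishes, or all dual weights are locally integrable. -/
theorem MemA.powMeasure_eq_zero_or {n m : ℕ} {P : Fin m → ℝ} (hP : ∀ i, 1 < P i) {q : ℝ}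
    (hq : 0 < q) {ω : Fin m → (Fin n → ℝ) → ℝ≥0} (hω : MemA P q ω) :
    powMeasure (prodWeight ω) q = 0 ∨
      ∀ i Q, IsCube Q → ∫⁻ x in Q, dualWeight (P i) (ω i) x ≠ ∞ := by
  rw [or_iff_not_imp_right]
  intro h
  push Not at h
  obtain ⟨i, Q, ⟨a, l, hl, rfl⟩, htop⟩ := h
  have hwm : AEMeasurable (fun x => prodWeight ω x ^ q) := (aemeasurable_prodWeight hω.1).pow_const q
  -- Concentric cubes containing the bad cube and exhausting the space. On each, one dual average is
  -- infinite and the others are nonzero, so finiteness of the `A_(P,q)` supremum forces the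
  -- integral of `ν_ω ^ q` to vanish.
  set D : ℕ → Set (Fin n → ℝ) := fun k => Set.Icc (fun j => a j - k) fun j => a j - k + (l + 2 * k)
    with hD
  have hcube : ∀ k, IsCube (D k) := fun k => ⟨_, l + 2 * k, by positivity, rfl⟩
  have hzero : ∀ k, ∫⁻ x in D k, prodWeight ω x ^ q = 0 := by
    intro k
    have hsub : (Set.Icc a fun j => a j + l) ⊆ D k := by
      refine fun x hx => ⟨fun j => ?_, fun j => ?_⟩
      · have := hx.1 j; have := k.cast_nonneg (α := ℝ); simp only; linarith
      · have := hx.2 j; have := k.cast_nonneg (α := ℝ); simp only at *; linarith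
    have htop' : ∫⁻ x in D k, dualWeight (P i) (ω i) x = ∞ :=
      top_le_iff.1 (htop ▸ lintegral_mono_set hsub)
    have hlt := (le_iSup₂_of_le (f := fun Q (_ : IsCube Q) =>
      (⨍⁻ x in Q, prodWeight ω x ^ q ∂volume) ^ (1 / q) *
        ∏ i, (⨍⁻ x in Q, dualWeight (P i) (ω i) x ∂volume) ^ (1 / (P i).conjExponent))
      (D k) (hcube k) le_rfl).trans_lt hω.2
    have hpos : ∀ i, 0 < 1 / (P i).conjExponent := fun i =>
      one_div_pos.2 (Real.HolderConjugate.conjExponent (hP i)).symm.pos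
    have hprod : ∏ i, (⨍⁻ x in D k, dualWeight (P i) (ω i) x ∂volume) ^ (1 / (P i).conjExponent)
        = ∞ := by
      rw [← Finset.mul_prod_erase _ _ (Finset.mem_univ i), setLAverage_eq, htop',
        ENNReal.top_div_of_ne_top (hcube k).volume_ne_top, ENNReal.top_rpow_of_pos (hpos i)]
      refine ENNReal.top_mul (Finset.prod_ne_zero_iff.2 fun j _ => ?_)
      rw [setLAverage_eq, ne_eq, ENNReal.rpow_eq_zero_iff_of_pos (hpos j), ENNReal.div_eq_zero_iff]
      push Not
      exact ⟨setLIntegral_ne_zero_of_pos (aemeasurable_dualWeight _ (hω.1 j))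
        (dualWeight_ne_zero (hP j) _) (hcube k).volume_ne_zero, (hcube k).volume_ne_top⟩
    rw [hprod] at hlt
    by_contra hne
    rw [ENNReal.mul_top] at hlt
    · exact lt_irrefl _ hlt
    · rw [setLAverage_eq, ne_eq, ENNReal.rpow_eq_zero_iff_of_pos (by positivity),
        ENNReal.div_eq_zero_iff]
      push Not
      exact ⟨hne, (hcube k).volume_ne_top⟩
  have hcover : ⋃ k, D k = Set.univ := by
    refine Set.eq_univ_of_forall fun x => ?_
    obtain ⟨k, hk⟩ := exists_nat_ge (‖x - a‖)
    refine Set.mem_iUnion.2 ⟨k, fun j => ?_, fun j => ?_⟩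
    all_goals
      have := abs_le.1 ((norm_le_pi_norm (x - a) j).trans hk)
      simp only [Pi.sub_apply] at this ⊢
      linarith [this.1, this.2]
  rw [powMeasure, ← Measure.measure_univ_eq_zero, withDensity_apply _ MeasurableSet.univ, ← hcover]
  exact le_antisymm ((lintegral_iUnion_le _ _).trans (by simp [hzero])) zero_le

theorem iUnion_gridCube {n : ℕ} (β : Fin n → Bool) :
    ⋃ z : Fin n → ℤ, gridCube β (0, z) = Set.univ :=
  Set.eq_univ_of_forall fun x => Set.mem_iUnion.2 ⟨gridIndex β 0 x, rfl⟩

/-- The dual weight is infinite wherever `w` vanishes, which local integrability allows only on a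
null set. Almost everywhere one may therefore divide by the dual weight. -/
theorem ae_ne_zero_of_dualWeight {n : ℕ} {p : ℝ} (hp : 1 < p) {w : (Fin n → ℝ) → ℝ≥0}
    (hw : AEMeasurable w) (h : ∀ Q, IsCube Q → ∫⁻ x in Q, dualWeight p w x ≠ ∞) :
    ∀ᵐ x, w x ≠ 0 := by
  have : 0 < p.conjExponent := (Real.HolderConjugate.conjExponent hp).symm.pos
  rw [← Measure.restrict_univ (μ := volume), ← iUnion_gridCube fun _ => false,
    ae_restrict_iUnion_iff]
  intro z
  have h1 := ae_lt_top' (aemeasurable_dualWeight p hw).restrict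
    ((setLIntegral_gridCube (fun _ => false) (0, z) _).trans_ne
      (h _ (isCube_closedGridCube (fun _ => false) (0, z))))
  filter_upwards [h1] with x hx h0
  rw [dualWeight, h0, ENNReal.coe_zero, ENNReal.zero_rpow_of_neg (by linarith)] at hx
  exact lt_irrefl _ hx

/-- The fractional maximal function is controlled by its dyadic versions. -/
theorem fractionalMaximal_rpow_le {n m : ℕ} {α q : ℝ} (hq : 0 < q)
    (hθ : 0 ≤ 1 - α / ((m : ℝ) * n)) (f : Fin m → (Fin n → ℝ) → ℂ) (x : Fin n → ℝ) :
    fractionalMaximal α f x ^ q ≤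
      ((((6 : ℝ≥0∞) ^ n) ^ (1 - α / ((m : ℝ) * n))) ^ m) ^ q * ∑ β : Fin n → Bool,
        ⨆ r, (gridCube β r).indicator (fun _ =>
          (∏ i, (volume.withDensity fun y => ‖f i y‖ₑ) (gridCube β r) /
            volume (gridCube β r) ^ (1 - α / ((m : ℝ) * n))) ^ q) x := by
  set θ := 1 - α / ((m : ℝ) * n)
  rw [← ENNReal.le_rpow_inv_iff hq]
  refine iSup_le fun Q => iSup₂_le fun hQ hx => ?_
  rw [ENNReal.le_rpow_inv_iff hq]
  obtain ⟨β, r, hsub, hvol⟩ := exists_gridCube hQ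
  have h1 : ∏ i, (∫⁻ y in Q, ‖f i y‖ₑ) / volume Q ^ θ ≤ (((6 : ℝ≥0∞) ^ n) ^ θ) ^ m *
      ∏ i, (volume.withDensity fun y => ‖f i y‖ₑ) (gridCube β r) / volume (gridCube β r) ^ θ := by
    rw [show (((6 : ℝ≥0∞) ^ n) ^ θ) ^ m = ∏ _i : Fin m, ((6 : ℝ≥0∞) ^ n) ^ θ by simp,
      ← Finset.prod_mul_distrib]
    refine Finset.prod_le_prod' fun i _ => ENNReal.div_le_of_le_mul ?_
    rw [withDensity_apply _ (measurableSet_gridCube β r)]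
    have hv0 : volume (gridCube β r) ^ θ ≠ 0 := by
      simp [ENNReal.rpow_eq_zero_iff, volume_gridCube_ne_zero, volume_gridCube_ne_top]
    have hv1 : volume (gridCube β r) ^ θ ≠ ∞ :=
      ENNReal.rpow_ne_top_of_nonneg hθ (volume_gridCube_ne_top β r)
    calc ∫⁻ y in Q, ‖f i y‖ₑ ≤ ∫⁻ y in gridCube β r, ‖f i y‖ₑ := lintegral_mono_set hsub
      _ = (∫⁻ y in gridCube β r, ‖f i y‖ₑ) / volume (gridCube β r) ^ θ *
          volume (gridCube β r) ^ θ := (ENNReal.div_mul_cancel hv0 hv1).symm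
      _ ≤ (∫⁻ y in gridCube β r, ‖f i y‖ₑ) / volume (gridCube β r) ^ θ *
          (6 ^ n * volume Q) ^ θ := by gcongr
      _ = _ := by rw [ENNReal.mul_rpow_of_nonneg _ _ hθ]; ring
  refine (ENNReal.rpow_le_rpow h1 hq.le).trans ?_
  rw [ENNReal.mul_rpow_of_nonneg _ _ hq.le]
  gcongr
  refine le_trans ?_ (Finset.single_le_sum (f := fun β => ⨆ r, (gridCube β r).indicator (fun _ =>
    (∏ i, (volume.withDensity fun y => ‖f i y‖ₑ) (gridCube β r) / volume (gridCube β r) ^ θ) ^ q) x)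
    (fun _ _ => zero_le) (Finset.mem_univ β))
  refine le_iSup_of_le r ?_
  rw [Set.indicator_of_mem (hsub hx)]

theorem setLIntegral_ne_top_of_locallyIntegrable {n : ℕ} {f : (Fin n → ℝ) → ℂ}
    (hf : LocallyIntegrable f volume) {Q : Set (Fin n → ℝ)} (hQ : IsCube Q) :
    ∫⁻ x in Q, ‖f x‖ₑ ≠ ∞ := by
  obtain ⟨a, l, -, rfl⟩ := hQ
  exact (hf.integrableOn_isCompact isCompact_Icc).2.ne

/-- The Hardy–Littlewood maximal function of the dual weight localized to a cube dominates its
averages over all dyadic subcubes. -/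
theorem average_le_hardyLittlewoodMaximal {n : ℕ} (β : Fin n → Bool) {r s : ℤ × (Fin n → ℤ)}
    (hrs : gridCube β r ⊆ gridCube β s) (σ : (Fin n → ℝ) → ℝ≥0∞) {x : Fin n → ℝ}
    (hx : x ∈ gridCube β r) :
    (∫⁻ y in gridCube β r, σ y) / volume (gridCube β r) ≤
      hardyLittlewoodMaximal ((closedGridCube β s).indicator σ) x := by
  refine le_trans (le_of_eq ?_) (le_iSup_of_le (closedGridCube β r)
    (le_iSup₂_of_le (isCube_closedGridCube β r) (gridCube_subset β r hx) le_rfl))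
  rw [setLAverage_eq, ← setLIntegral_gridCube, ← volume_gridCube_eq_closed]
  congr 1
  refine setLIntegral_congr_fun (measurableSet_gridCube β r) fun y hy => ?_
  exact (Set.indicator_of_mem (gridCube_subset β s (hrs hy)) σ).symm

/-- With `a = |f x|`, this says that `|f| * w ^ p'` is the density of `|f| dx` with respect to the
dual weight. -/
theorem mul_dualWeight {p : ℝ} {n : ℕ} {w : (Fin n → ℝ) → ℝ≥0} {x : Fin n → ℝ}
    (h0 : w x ≠ 0) (a : ℝ≥0) :
    ((a * w x ^ p.conjExponent : ℝ≥0) : ℝ≥0∞) * dualWeight p w x = a := by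
  rw [dualWeight, ENNReal.rpow_neg, ENNReal.coe_mul, ENNReal.coe_rpow_of_ne_zero h0, mul_assoc,
    ENNReal.mul_inv_cancel, mul_one]
  · simp [ENNReal.rpow_eq_zero_iff, h0]
  · simp [ENNReal.rpow_eq_top_iff, h0]

/-- Since `p * p' - p' = p`, the `L^p` norm of that density with respect to the dual weight is the
norm of `f` in `L^p(w^p)`. -/
theorem rpow_mul_dualWeight {p : ℝ} (hp : 1 < p) {n : ℕ} {w : (Fin n → ℝ) → ℝ≥0} {x : Fin n → ℝ}
    (h0 : w x ≠ 0) (a : ℝ≥0) :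
    ((a * w x ^ p.conjExponent : ℝ≥0) : ℝ≥0∞) ^ p * dualWeight p w x =
      (a : ℝ≥0∞) ^ p * (w x : ℝ≥0∞) ^ p := by
  have hc := (Real.HolderConjugate.conjExponent hp)
  have h0' : (w x : ℝ≥0∞) ≠ 0 := by exact_mod_cast h0
  rw [dualWeight, ENNReal.coe_mul, ENNReal.mul_rpow_of_nonneg _ _ (by linarith), mul_assoc,
    ENNReal.coe_rpow_of_ne_zero h0, ← ENNReal.rpow_mul,
    ← ENNReal.rpow_add _ _ h0' ENNReal.coe_ne_top]
  congr 2
  have h1 := hc.mul_eq_add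
  linarith

theorem eLpNorm_rpow_powMeasure {n : ℕ} {p : ℝ} (hp : 1 < p) {w : (Fin n → ℝ) → ℝ≥0}
    (hw : AEMeasurable w) {f : (Fin n → ℝ) → ℂ} (hf : AEStronglyMeasurable f volume) :
    eLpNorm f (ENNReal.ofReal p) (powMeasure (fun x => (w x : ℝ≥0∞)) p) =
      (∫⁻ x, ‖f x‖ₑ ^ p * (w x : ℝ≥0∞) ^ p) ^ (1 / p) := by
  have hp0 : 0 < p := by linarith
  rw [eLpNorm_eq_lintegral_rpow_enorm_toReal (by simpa using hp0) ENNReal.ofReal_ne_top,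
    ENNReal.toReal_ofReal hp0.le, powMeasure,
    lintegral_withDensity_eq_lintegral_mul₀ (hw.coe_nnreal_ennreal.pow_const _)
      (hf.enorm.pow_const _)]
  simp only [Pi.mul_apply, mul_comm]

/-! ### The estimate on one grid. -/

/-- The estimate for the maximal operator of a single dyadic grid. -/
theorem lintegral_iSup_gridCube_le {n m : ℕ} (hm : 0 < m) {P : Fin m → ℝ} {p q θ : ℝ}
    (hP : ∀ i, 1 < P i) (hp : 1 / p = ∑ i, 1 / P i) (hp0 : 0 < p) (hpq : p ≤ q)
    (hθ0 : 0 ≤ θ) (hθ1 : θ ≤ 1) (hθ : 1 + ∑ i, q / (P i).conjExponent = m * q * θ)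
    {ω : Fin m → (Fin n → ℝ) → ℝ≥0} (hω : ∀ i, AEMeasurable (ω i))
    (hfin : ∀ i Q, IsCube Q → ∫⁻ x in Q, dualWeight (P i) (ω i) x ≠ ∞)
    {f : Fin m → (Fin n → ℝ) → ℂ} (hf : ∀ i, LocallyIntegrable (f i) volume) (β : Fin n → Bool) :
    ∫⁻ x, (⨆ r, (gridCube β r).indicator (fun _ =>
        (∏ i, (volume.withDensity fun y => ‖f i y‖ₑ) (gridCube β r) /
          volume (gridCube β r) ^ θ) ^ q) x) ∂(powMeasure (prodWeight ω) q) ≤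
      (2 ^ m) ^ q * aConst P q ω * ∏ i, (ENNReal.ofReal (carlesonConst (P i)) *
        (2 * aInftyConst (dualWeight (P i) (ω i))) *
        ∫⁻ x, ‖f i x‖ₑ ^ P i * (ω i x : ℝ≥0∞) ^ P i) ^ (q / P i) := by
  classical
  refine lintegral_iSup_le_of_finset _
    (fun r => measurable_const.indicator (measurableSet_gridCube β r)) fun s => ?_
  set σ : Fin m → Measure (Fin n → ℝ) := fun i => volume.withDensity (dualWeight (P i) (ω i))
  set κ : Fin m → Measure (Fin n → ℝ) := fun i => volume.withDensity fun y => ‖f i y‖ₑ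
  have hσm := fun i => aemeasurable_dualWeight (P i) (hω i)
  have hne := fun i => ae_ne_zero_of_dualWeight (hP i) (hω i) (hfin i)
  have hfm := fun i => (hf i).aestronglyMeasurable
  -- This is `|f i| / σ i`, written with a positive power of `ω i` so that it stays finite; a
  -- measurable representative is used below.
  have hgm : ∀ i, AEMeasurable fun x => ‖f i x‖₊ * ω i x ^ (P i).conjExponent := fun i =>
    (hfm i).nnnorm.aemeasurable.mul ((hω i).pow_const _)
  set g : Fin m → (Fin n → ℝ) → ℝ≥0 := fun i => (hgm i).mk
  have hgeq : ∀ i, ∀ᵐ x, g i x = ‖f i x‖₊ * ω i x ^ (P i).conjExponent := fun i =>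
    (hgm i).ae_eq_mk.symm
  have hσr : ∀ i r, σ i (gridCube β r) =
      ∫⁻ x in closedGridCube β r, dualWeight (P i) (ω i) x := fun i r => by
    rw [withDensity_apply _ (measurableSet_gridCube β r), setLIntegral_gridCube]
  have hκr : ∀ i r, κ i (gridCube β r) = ∫⁻ x in closedGridCube β r, ‖f i x‖ₑ := fun i r => by
    rw [withDensity_apply _ (measurableSet_gridCube β r), setLIntegral_gridCube]
  have hσ0 : ∀ i r, σ i (gridCube β r) ≠ 0 := fun i r => by
    rw [hσr]
    exact setLIntegral_ne_zero_of_pos (hσm i) (dualWeight_ne_zero (hP i) _)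
      (isCube_closedGridCube β r).volume_ne_zero
  have hσtop : ∀ i r, σ i (gridCube β r) ≠ ∞ := fun i r => by
    rw [hσr]; exact hfin i _ (isCube_closedGridCube β r)
  have hgI : ∀ i, ∫⁻ x, ENNReal.ofReal (g i x) ^ P i ∂σ i =
      ∫⁻ x, ‖f i x‖ₑ ^ P i * (ω i x : ℝ≥0∞) ^ P i := by
    intro i
    rw [lintegral_withDensity_eq_lintegral_mul₀ (hσm i)
      (by simp only [ENNReal.ofReal_coe_nnreal]
          exact ((hgm i).measurable_mk.coe_nnreal_ennreal.pow_const _).aemeasurable)]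
    refine lintegral_congr_ae ?_
    filter_upwards [hgeq i, hne i] with x hx hx0
    rw [Pi.mul_apply, ENNReal.ofReal_coe_nnreal, hx, mul_comm,
      rpow_mul_dualWeight (hP i) hx0, enorm_eq_nnnorm]
  have hκg : ∀ i r, κ i (gridCube β r) =
      ∫⁻ x in gridCube β r, ENNReal.ofReal (g i x) ∂σ i := by
    intro i r
    rw [withDensity_apply _ (measurableSet_gridCube β r),
      restrict_withDensity (measurableSet_gridCube β r),
      lintegral_withDensity_eq_lintegral_mul₀ (hσm i).restrict
      (by simp only [ENNReal.ofReal_coe_nnreal]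
          exact ((hgm i).measurable_mk.coe_nnreal_ennreal).aemeasurable)]
    refine lintegral_congr_ae (ae_restrict_of_ae ?_)
    filter_upwards [hgeq i, hne i] with x hx hx0
    rw [Pi.mul_apply, ENNReal.ofReal_coe_nnreal, hx, mul_comm,
      mul_dualWeight hx0, enorm_eq_nnnorm]
  set G : Finset (Set (Fin n → ℝ)) := s.image (gridCube β) with hGdef
  have hmem : ∀ {Q}, Q ∈ G → ∃ r, Q = gridCube β r := fun hQ => by
    obtain ⟨r, -, rfl⟩ := Finset.mem_image.1 hQ
    exact ⟨r, rfl⟩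
  have hG : Laminar G := by
    intro Q hQ R hR
    obtain ⟨r, rfl⟩ := hmem hQ
    obtain ⟨t, rfl⟩ := hmem hR
    exact gridCube_nested β r t
  have hforall : ∀ {p : Set (Fin n → ℝ) → Prop}, (∀ r, p (gridCube β r)) → ∀ Q ∈ G, p Q := by
    intro p hp Q hQ
    obtain ⟨r, rfl⟩ := hmem hQ
    exact hp r
  have main := hG.lintegral_iSup_le (hforall (measurableSet_gridCube β)) volume
    (powMeasure (prodWeight ω) q) (hforall (volume_gridCube_ne_zero β))
    (hforall (volume_gridCube_ne_top β)) hm κ σ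
    (fun i => hforall fun r => by
      rw [hκr]; exact setLIntegral_ne_top_of_locallyIntegrable (hf i) (isCube_closedGridCube β r))
    (fun i => hforall (hσ0 i)) (fun i => hforall (hσtop i)) (g := fun i x => (g i x : ℝ))
    (fun i => (hgm i).measurable_mk.coe_nnreal_real) (fun i x => (g i x).2)
    (fun i => hforall (hκg i)) hP hp hp0 hpq hθ0 hθ1 (K := aConst P q ω)
    (hforall fun r => ?_) (L := fun i => aInftyConst (dualWeight (P i) (ω i)))
    (fun i => hforall fun t => ?_)
  · simp_rw [hgI] at main
    refine le_trans (lintegral_mono fun x => ?_) main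
    rw [hGdef, Finset.iSup_finset_image]
  · rw [← hθ]
    refine mul_prod_rpow_le_of_average (volume_gridCube_ne_zero β r) (volume_gridCube_ne_top β r) _
      (fun i => div_nonneg (hp0.le.trans hpq)
        (Real.HolderConjugate.conjExponent (hP i)).symm.pos.le) ?_
    refine le_trans (le_of_eq ?_) (le_aConst P q ω (isCube_closedGridCube β r))
    rw [powMeasure, withDensity_apply _ (measurableSet_gridCube β r), setLIntegral_gridCube]
    simp_rw [hσr, setLAverage_eq, volume_gridCube_eq_closed]
  -- The dominating function is the maximal function of the dual weight cut off to the closed top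
  -- cube: it exceeds the averages over all dyadic subcubes, and the `A_∞` constant bounds its
  -- integral.
  · refine ⟨hardyLittlewoodMaximal ((closedGridCube β t).indicator (dualWeight (P i) (ω i))),
      fun Q hQ hsub x hx => ?_, ?_⟩
    · obtain ⟨r, rfl⟩ := hmem hQ
      rw [withDensity_apply _ (measurableSet_gridCube β r)]
      exact average_le_hardyLittlewoodMaximal β hsub _ hx
    · rw [setLIntegral_gridCube, hσr]
      refine lintegral_hardyLittlewoodMaximal_le _ (isCube_closedGridCube β t) ?_ ?_
      · rw [← hσr]; exact hσ0 i t
      · rw [← hσr]; exact hσtop i t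

end MultilinearFractional

/-! ### Exponent bookkeeping and assembly. -/

theorem corollary1p3 (n m : ℕ) (P : Fin m → ℝ) (p q α : ℝ)
    (hP : ∀ i, 1 < P i) (hp : 1 / p = ∑ i, 1 / P i)
    (hα : 0 < α) (hαmn : α < (m : ℝ) * n)
    (hp_lower : 1 / (m : ℝ) < p) (hp_upper : p < (n : ℝ) / α)
    (hq : 1 / q = 1 / p - α / n) :
    ∃ C : ℝ≥0, ∀ ω : Fin m → (Fin n → ℝ) → ℝ≥0, MultilinearFractional.MemA P q ω →
      ∀ f : Fin m → (Fin n → ℝ) → ℂ, (∀ i, LocallyIntegrable (f i) volume) →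
        eLpNorm (MultilinearFractional.fractionalMaximal α f) (ENNReal.ofReal q)
            (MultilinearFractional.powMeasure (MultilinearFractional.prodWeight ω) q)
          ≤ (C : ℝ≥0∞) * MultilinearFractional.aConst P q ω ^ (1 / q) *
            (∏ i, MultilinearFractional.aInftyConst
                (MultilinearFractional.dualWeight (P i) (ω i)) ^ (1 / P i)) *
            ∏ i, eLpNorm (f i) (ENNReal.ofReal (P i))
              (MultilinearFractional.powMeasure (fun x => (ω i x : ℝ≥0∞)) (P i)) := by
  open MultilinearFractional in
  have hmn : (0 : ℝ) < m * n := hα.trans hαmn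
  have hm0 : (0 : ℝ) < m := by
    rcases (Nat.cast_nonneg m : (0 : ℝ) ≤ m).eq_or_lt with h | h
    · rw [← h] at hmn; simp at hmn
    · exact h
  have hn0 : (0 : ℝ) < n := pos_of_mul_pos_right hmn hm0.le
  have hm : 0 < m := by exact_mod_cast hm0
  have hp0 : 0 < p := lt_trans (by positivity) hp_lower
  have hq0 : 0 < q := by
    rw [← one_div_pos, hq, sub_pos, div_lt_div_iff₀ hn0 hp0]
    rw [lt_div_iff₀ hα] at hp_upper
    linarith
  have hpq : p ≤ q := by
    rw [← one_div_le_one_div hq0 hp0, hq]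
    have : 0 < α / n := by positivity
    linarith
  set θ : ℝ := 1 - α / ((m : ℝ) * n) with hθdef
  have hθ0 : 0 ≤ θ := by
    rw [hθdef, sub_nonneg, div_le_one hmn]; exact hαmn.le
  have hθ1 : θ ≤ 1 := by
    have : 0 < α / ((m : ℝ) * n) := by positivity
    rw [hθdef]; linarith
  -- Both sides equal `m * q - q * α / n`, because `q / p = 1 + q * α / n`. This scaling identity
  -- matches the averages in `A_(P,q)` with the fractional normalization.
  have hθ : 1 + ∑ i, q / (P i).conjExponent = m * q * θ := by
    have h1 : ∀ i, q / (P i).conjExponent = q - q * (1 / P i) := fun i => by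
      have := (Real.HolderConjugate.conjExponent (hP i)).inv_add_inv_eq_one
      rw [div_eq_mul_inv, eq_sub_iff_add_eq'.2 this]
      ring
    rw [Finset.sum_congr rfl fun i _ => h1 i, Finset.sum_sub_distrib, ← Finset.mul_sum, ← hp]
    have h2 : 1 / p = 1 / q + α / n := by linarith
    rw [h2, hθdef]
    simp
    field_simp
    ring
  -- The factors come from enlarging cubes to dyadic ones (`6 ^ n` in volume), from the number of
  -- grids, and from the principal selection.
  set A : ℝ≥0∞ := ((((6 : ℝ≥0∞) ^ n) ^ θ) ^ m) ^ q * (Fintype.card (Fin n → Bool) * (2 ^ m) ^ q)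
    with hA
  set B : ℝ≥0∞ := ∏ i, (ENNReal.ofReal (carlesonConst (P i)) * 2) ^ (1 / P i) with hB
  have hPpos : ∀ i, 0 < P i := fun i => by linarith [hP i]
  have hAtop : A ^ (1 / q) ≠ ∞ := by
    refine ENNReal.rpow_ne_top_of_nonneg (by positivity) (ENNReal.mul_ne_top ?_
      (ENNReal.mul_ne_top (ENNReal.natCast_ne_top _) ?_))
    · exact ENNReal.rpow_ne_top_of_nonneg hq0.le
        (ENNReal.pow_ne_top (ENNReal.rpow_ne_top_of_nonneg hθ0 (by simp)))
    · exact ENNReal.rpow_ne_top_of_nonneg hq0.le (by simp)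
  have hBtop : B ≠ ∞ := ENNReal.prod_ne_top fun i _ => ENNReal.rpow_ne_top_of_nonneg
    (one_div_nonneg.2 (hPpos i).le) (ENNReal.mul_ne_top ENNReal.ofReal_ne_top (by simp))
  refine ⟨(A ^ (1 / q) * B).toNNReal, fun ω hω f hf => ?_⟩
  rw [ENNReal.coe_toNNReal (ENNReal.mul_ne_top hAtop hBtop)]
  -- In the degenerate case the left-hand norm is taken in the zero measure.
  rcases hω.powMeasure_eq_zero_or hP hq0 with h | hfin
  · rw [h, eLpNorm_measure_zero]; exact zero_le
  have hgrid := lintegral_iSup_gridCube_le hm hP hp hp0 hpq hθ0 hθ1 hθ hω.1 hfin hf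
  set I : Fin m → ℝ≥0∞ := fun i => ∫⁻ x, ‖f i x‖ₑ ^ P i * (ω i x : ℝ≥0∞) ^ P i with hI
  set D : ℝ≥0∞ := ∏ i, (ENNReal.ofReal (carlesonConst (P i)) *
        (2 * aInftyConst (dualWeight (P i) (ω i))) * I i) ^ (q / P i) with hD
  have hint : ∫⁻ x, fractionalMaximal α f x ^ q ∂(powMeasure (prodWeight ω) q) ≤
      A * aConst P q ω * D := by
    refine (lintegral_mono fun x => fractionalMaximal_rpow_le hq0 hθ0 f x).trans ?_
    have hmeas : ∀ β : Fin n → Bool, Measurable fun x => ⨆ r, (gridCube β r).indicator (fun _ =>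
          (∏ i, (volume.withDensity fun y => ‖f i y‖ₑ) (gridCube β r) /
            volume (gridCube β r) ^ θ) ^ q) x := fun β =>
      Measurable.iSup fun r => measurable_const.indicator (measurableSet_gridCube β r)
    rw [lintegral_const_mul _ (Finset.measurable_fun_sum _ fun β _ => hmeas β),
      lintegral_finsetSum _ fun β _ => hmeas β]
    refine (mul_le_mul_right (Finset.sum_le_sum fun β _ => hgrid β) _).trans_eq ?_
    rw [Finset.sum_const, Finset.card_univ, nsmul_eq_mul, hA]
    ring
  have hDq : D ^ (1 / q) = B * (∏ i, aInftyConst (dualWeight (P i) (ω i)) ^ (1 / P i)) *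
      ∏ i, I i ^ (1 / P i) := by
    rw [hD, hB, ← ENNReal.prod_rpow_of_nonneg (by positivity), ← Finset.prod_mul_distrib,
      ← Finset.prod_mul_distrib]
    refine Finset.prod_congr rfl fun i _ => ?_
    have hi : 0 ≤ 1 / P i := one_div_nonneg.2 (hPpos i).le
    rw [← ENNReal.rpow_mul, show q / P i * (1 / q) = 1 / P i by field_simp, ← mul_assoc,
      ENNReal.mul_rpow_of_nonneg _ _ hi, ENNReal.mul_rpow_of_nonneg _ _ hi]
  rw [eLpNorm_eq_lintegral_rpow_enorm_toReal (by simpa using hq0) ENNReal.ofReal_ne_top,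
    ENNReal.toReal_ofReal hq0.le]
  simp_rw [enorm_eq_self]
  refine (ENNReal.rpow_le_rpow hint (by positivity)).trans_eq ?_
  rw [ENNReal.mul_rpow_of_nonneg _ _ (by positivity), ENNReal.mul_rpow_of_nonneg _ _ (by positivity),
    hDq, Finset.prod_congr rfl fun i _ => eLpNorm_rpow_powMeasure (hP i) (hω.1 i)
      (hf i).aestronglyMeasurable]
  ring
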